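/- Conventions. A graded space is a finite-dimensional complex space with a homogeneous basis; $|\cdot|\in\mathbb Z_2$ is the parity of a basis vector. A tensor $\mathcal U$ with physical space of dimension $d$ and finite-dimensional auxiliary space is a family of matrices $U^{n,m}$ ($n$ output, $m$ input), and it is even if $U^{n,m}_{\alpha,\beta}=0$ unless $|n|+|m|+|\alpha|+|\beta|=0$. On $N$ sites, with antiperiodic boundary conditions and boundary constant $c$, it generates $$\sum_{n,m} c\,\mathrm{tr}(U^{n_1,m_1}\cdots U^{n_N,m_N})\,f_1^{n_1,m_1}\cdots f_N^{n_N,m_N},$$ where $f_j^{n,m}$ replaces $m$ by $n$ on site $j$ of the ordered product $(a_1^\dagger)^{t_1}\cdots(a_N^\dagger)^{t_N}|\Omega\rangle$, with the sign $(-1)^{(|n|+|m|)\sum_{i<j}|t_i|}$. An even tensor generates a type I fMPU if for some $\theta\in\mathbb R$ the operators with $c=e^{i\theta}$ are unitary for all $N\ge1$. The blocked tensor $\mathcal U_k$ has matrices $\prod_{i<j}(-1)^{|m_i|(|n_j|+|m_j|)}\,U^{n_1,m_1}\cdots U^{n_k,m_k}$, and physical parity $\sum_j|n_j|$. The composition of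 $\mathcal U$ and $\mathcal V$ is the tensor $$W^{k,i}_{(\alpha,\gamma),(\beta,\delta)}=\sum_j(-1)^{|\gamma|(|k|+|j|)}U^{k,j}_{\alpha,\beta}V^{j,i}_{\gamma,\delta}.$$ The right rank $r$ and left rank $\ell$ of $\mathcal U$ are the ranks of the linear maps $$|m\rangle\otimes|\alpha)\mapsto\sum_{n,\beta}(-1)^{|n||m|}U^{n,m}_{\alpha,\beta}|n\rangle\otimes|\beta),\qquad |m\rangle\otimes|\beta)\mapsto\sum_{n,\alpha}U^{n,m}_{\alpha,\beta}|n\rangle\otimes|\alpha),$$ and its exponentiated index is $\mathcal I_f(\mathcal U)=\sqrt{r/\ell}$. Put $\mathbb U^{k,i}_{(\alpha,\gamma),(\beta,\delta)}=\sum_j(-1)^{|\beta|(|k|+|i|)}\overline{U^{j,k}_{\alpha,\beta}}U^{j,i}_{\gamma,\delta}$ and $E=\frac1d\sum_i\mathbb U^{i,i}$. The tensor $\mathcal U$ is simple if $E\,\mathbb U^{k,i}E=\delta_{k,i}E$, $\ \mathbb U^{n,m}\mathbb U^{n',m'}=\mathbb U^{n,m}E\,\mathbb U^{n',m'}$ and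 $E^2=E$. An even tensor $\mathcal A$ is graded normal if no proper nonzero graded subspace of the auxiliary space is invariant under all matrices $A^{n,m}$, and $\sum_{n,m}\overline{A^{n,m}}\otimes A^{n,m}$ has spectral radius $1$ with $1$ as its only eigenvalue of modulus $1$, of multiplicity $1$ or $2$. An even tensor is in graded canonical form (GCF) if $U^{n,m}=\bigoplus_i\mu_iA_i^{n,m}$ with $\mu_i\in\mathbb C$ and graded normal $\mathcal A_i$, where the auxiliary parity operator has the same block structure. Majorana shift. Let $x\ge1$ and let $\mathcal Y$ be a graded space of dimension $x$. The tensor $\mathcal M$ on $\mathbb C^{1|1}$, with auxiliary space $\mathbb C^{1|1}$, has the matrices $M^{n,m}=\frac{1}{\sqrt2}i^m(\sigma^x)^{n+m}$, $n,m\in\{0,1\}$. Let $\mathcal M^{(x)}=\mathcal M\otimes_{\mathfrak g}\mathbb 1_x$, with local space $\mathbb C^{1|1}\otimes_{\mathfrak g}\mathcal Y$ of dimension $d=2x$. With boundary constant $1/\sqrt2$ it generates the Majorana shift $M_A^{(N)}$ (acting as the identity on the ancillas). (1) For every $k\ge1$ the right and left ranks of the blocked tensor $\mathcal M^{(x)}_k$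 are $r_k=2d^k$ and $\ell_k=d^k$. (2) Let $\tilde{\mathcal U}$ be an even tensor in GCF on the same local space generating a type I fMPU $\tilde U^{(N)}$ with antiperiodic boundary conditions, and let $\mathcal U$ be the composition of $\tilde{\mathcal U}$ and $\mathcal M^{(x)}$. Then $\mathcal U$, with boundary constant $e^{i\theta}/\sqrt2$, generates $U^{(N)}=\tilde U^{(N)}M_A^{(N)}$, where $\tilde U^{(N)}$ is taken with boundary constant $e^{i\theta}$ (this is the standard form of a type II fMPU). If $k\ge1$ and $\tilde{\mathcal U}_k$ is simple, then for every $q\ge2k$ the left ranks of $\tilde{\mathcal U}_k$ and $\mathcal U_q$ are positive and $$\mathcal I_f(\mathcal U_q)=\sqrt2\;\mathcal I_f(\tilde{\mathcal U}_k).$$ -/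

import Mathlib

open Matrix

noncomputable section

namespace FMPU

/-! ### Even local tensors

A basis of a `ℤ₂`-graded space is a finite type with a parity map to `ZMod 2`. A matrix product
operator tensor with physical basis `P` and auxiliary basis `A` is the family of its matrices
`U n m`, where `n` is the outgoing and `m` the incoming physical index; the entry
`U n m α β` carries the left auxiliary index `α` and the right auxiliary index `β`. -/

/-- The sign `(-1) ^ a` of `a : ZMod 2`. -/
def sgn (a : ZMod 2) : ℂ := if a = 0 then 1 else -1

/-- The tensors `U^{n,m}_{α,β}`. -/
abbrev MPOTensor (P A : Type*) := P → P → Matrix A A ℂ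

/-- The tensor is even: `U^{n,m}_{α,β} = 0` unless `|n| + |m| + |α| + |β| = 0` modulo `2`. -/
def IsEven {P A : Type*} (p : P → ZMod 2) (a : A → ZMod 2) (U : MPOTensor P A) : Prop :=
  ∀ n m α β, U n m α β ≠ 0 → p n + p m + a α + a β = 0

/-- The parity of a tensor product basis vector. -/
def addParity {P Q : Type*} (p : P → ZMod 2) (q : Q → ZMod 2) : P × Q → ZMod 2 :=
  fun x => p x.1 + q x.2

/-- The parity of a basis vector of `k` sites. -/
def chainParity {P : Type*} (p : P → ZMod 2) (k : ℕ) : (Fin k → P) → ZMod 2 :=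
  fun n => ∑ j, p (n j)

/-! ### The operators generated with antiperiodic boundary conditions -/

/-- The operator `f_j^{a,b}` on the fermionic chain with `N` sites, in the basis of ordered
products `(a_1†)^{t_1} ⋯ (a_N†)^{t_N} |Ω⟩`: it replaces `b` by `a` on site `j`, and passing the
factors of the sites before `j` costs the sign `(-1)^{(|a| + |b|) |t_i|}` each. -/
def siteOp {P : Type*} [DecidableEq P] (p : P → ZMod 2) {N : ℕ} (j : Fin N) (a b : P) :
    Matrix (Fin N → P) (Fin N → P) ℂ :=
  Matrix.of fun s t =>
    if t j = b ∧ s = Function.update t j a then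
      ∏ i ∈ Finset.Iio j, sgn ((p a + p b) * p (t i))
    else 0

/-- The operator `∑ tr(S U^{n_1,m_1} ⋯ U^{n_N,m_N}) f_1^{n_1,m_1} ⋯ f_N^{n_N,m_N}` with boundary
matrix `S = c 𝟙`. -/
def abcOperator {P A : Type*} [Fintype P] [DecidableEq P] [Fintype A] [DecidableEq A]
    (p : P → ZMod 2) (c : ℂ) (U : MPOTensor P A) (N : ℕ) :
    Matrix (Fin N → P) (Fin N → P) ℂ :=
  ∑ n : Fin N → P, ∑ m : Fin N → P,
    (c * Matrix.trace (List.ofFn fun j => U (n j) (m j)).prod) •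
      (List.ofFn fun j => siteOp p j (n j) (m j)).prod

/-- The even tensor `U` generates a type I fMPU with antiperiodic boundary conditions: with a
boundary matrix `e^{iθ} 𝟙` the operators are unitary for all `N ≥ 1`. -/
def GeneratesTypeI {P A : Type*} [Fintype P] [DecidableEq P] [Fintype A] [DecidableEq A]
    (p : P → ZMod 2) (a : A → ZMod 2) (U : MPOTensor P A) : Prop :=
  IsEven p a U ∧ ∃ θ : ℝ, ∀ N : ℕ, 1 ≤ N →
    abcOperator p (Complex.exp (θ * Complex.I)) U N ∈ Matrix.unitaryGroup (Fin N → P) ℂ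

/-! ### Elementary operations -/

/-- Blocking `k` consecutive sites. Blocking two sites multiplies the entries by
`(-1)^{|m_1| (|n_2| + |m_2|)}`; iterating this gives one such sign for every pair of sites. -/
def block {P A : Type*} [Fintype A] [DecidableEq A] (p : P → ZMod 2) (U : MPOTensor P A)
    (k : ℕ) : MPOTensor (Fin k → P) A :=
  fun n m => (∏ j, ∏ i ∈ Finset.Iio j, sgn (p (m i) * (p (n j) + p (m j)))) •
    (List.ofFn fun j => U (n j) (m j)).prod

/-- The graded tensor product of the tensor with the identity of an ancilla with basis `Y`. -/
def withAncilla {P A : Type*} (Y : Type*) [DecidableEq Y] (U : MPOTensor P A) :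
    MPOTensor (P × Y) A :=
  fun n m => if n.2 = m.2 then U n.1 m.1 else 0

/-- The tensor of the product of the operators of `U` and `V`:
`W^{k,i}_{(α,γ),(β,δ)} = ∑_j (-1)^{|γ| (|k| + |j|)} U^{k,j}_{α,β} V^{j,i}_{γ,δ}`. -/
def compose {P A B : Type*} [Fintype P] (p : P → ZMod 2) (b : B → ZMod 2)
    (U : MPOTensor P A) (V : MPOTensor P B) : MPOTensor P (A × B) :=
  fun k i => Matrix.of fun x y =>
    ∑ j, sgn (b x.2 * (p k + p j)) * U k j x.1 y.1 * V j i x.2 y.2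

/-- The transfer matrix `∑_{n,m} conj(U^{n,m}) ⊗ U^{n,m}` of the tensor, seen as a matrix product
state tensor with the pair `(n, m)` as its physical index. -/
def transferMatrix {P A : Type*} [Fintype P] (U : MPOTensor P A) : Matrix (A × A) (A × A) ℂ :=
  Matrix.of fun x y => ∑ n, ∑ m, star (U n m x.1 y.1) * U n m x.2 y.2

/-- The transfer matrix `E_U` of an operator tensor, normalized by the physical dimension. -/
def normTransferMatrix {P A : Type*} [Fintype P] (U : MPOTensor P A) :
    Matrix (A × A) (A × A) ℂ :=
  ((Fintype.card P : ℂ)⁻¹) • transferMatrix U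

/-- The tensor of `U^{(N)†} U^{(N)}`:
`∑_j (-1)^{|β| (|k| + |i|)} conj(U^{j,k}_{α,β}) U^{j,i}_{γ,δ}`, with auxiliary indices
`(α, γ)` and `(β, δ)`. -/
def stacked {P A : Type*} [Fintype P] (p : P → ZMod 2) (a : A → ZMod 2) (U : MPOTensor P A) :
    MPOTensor P (A × A) :=
  fun k i => Matrix.of fun x y =>
    ∑ j, sgn (a y.1 * (p k + p i)) * star (U j k x.1 y.1) * U j i x.2 y.2

/-- Simple tensors. With `E` the normalized transfer matrix and `𝕌` the tensor of `U†U`, the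
conditions are `E 𝕌 E = E ⊗ 𝟙`, `𝕌 𝕌 = 𝕌 E 𝕌` and `E² = E`. The blocking sign of two copies of `𝕌`
depends only on the physical indices and is the same on both sides. -/
def IsSimple {P A : Type*} [Fintype P] [DecidableEq P] [Fintype A]
    (p : P → ZMod 2) (a : A → ZMod 2) (U : MPOTensor P A) : Prop :=
  (∀ k i, normTransferMatrix U * stacked p a U k i * normTransferMatrix U =
      if k = i then normTransferMatrix U else 0) ∧
  (∀ n m n' m', stacked p a U n m * stacked p a U n' m' =
      stacked p a U n m * normTransferMatrix U * stacked p a U n' m') ∧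
  normTransferMatrix U * normTransferMatrix U = normTransferMatrix U

/-! ### Graded canonical form -/

/-- The auxiliary parity operator. -/
def parityOp {A : Type*} [DecidableEq A] (a : A → ZMod 2) : Matrix A A ℂ :=
  Matrix.diagonal fun α => sgn (a α)

/-- No subspace other than `0` and the whole space is both graded and invariant under all
matrices of the tensor. -/
def IsGradedIrreducible {P A : Type*} [Fintype A] [DecidableEq A] (a : A → ZMod 2)
    (U : MPOTensor P A) : Prop :=
  ∀ W : Submodule ℂ (A → ℂ), (∀ v ∈ W, parityOp a *ᵥ v ∈ W) →
    (∀ n m, ∀ v ∈ W, U n m *ᵥ v ∈ W) → W = ⊥ ∨ W = ⊤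

/-- Graded normal tensors: even, graded irreducible, and the transfer matrix has spectral radius
`1`, with `1` as its only eigenvalue of modulus `1`, of multiplicity one (non-degenerate) or two
(degenerate). -/
def IsGradedNormal {P A : Type*} [Fintype P] [Fintype A] [DecidableEq A]
    (p : P → ZMod 2) (a : A → ZMod 2) (U : MPOTensor P A) : Prop :=
  IsEven p a U ∧ IsGradedIrreducible a U ∧
  (∀ z ∈ (transferMatrix U).charpoly.roots, ‖z‖ < 1 ∨ z = 1) ∧
  ((transferMatrix U).charpoly.rootMultiplicity 1 = 1 ∨
    (transferMatrix U).charpoly.rootMultiplicity 1 = 2)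

/-- Graded canonical form: `U^{n,m} = ⊕_i μ_i A_i^{n,m}` with graded normal tensors `A_i`. The map
`b` sends an auxiliary basis vector to its block; the parity operator is diagonal, so that it has
the same block structure. -/
def IsGCF {P A : Type*} [Fintype P] [Fintype A] [DecidableEq A]
    (p : P → ZMod 2) (a : A → ZMod 2) (U : MPOTensor P A) : Prop :=
  IsEven p a U ∧
  ∃ (r : ℕ) (b : A → Fin r) (μ : Fin r → ℂ) (B : ∀ i, MPOTensor P {α : A // b α = i}),
    (∀ n m α β, b α ≠ b β → U n m α β = 0) ∧
    (∀ i n m (α β : {α : A // b α = i}), U n m α β = μ i * B i n m α β) ∧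
    ∀ i, IsGradedNormal p (fun α : {α : A // b α = i} => a α) (B i)

/-! ### Ranks and index -/

/-- The map `|m⟩ ⊗ |α) ↦ (-1)^{|n||m|} U^{n,m}_{α,β} |n⟩ ⊗ |β)`. -/
def rightMap {P A : Type*} (p : P → ZMod 2) (U : MPOTensor P A) : Matrix (P × A) (P × A) ℂ :=
  Matrix.of fun x y => sgn (p x.1 * p y.1) * U x.1 y.1 y.2 x.2

/-- The map `|m⟩ ⊗ |β) ↦ U^{n,m}_{α,β} |n⟩ ⊗ |α)`. -/
def leftMap {P A : Type*} (U : MPOTensor P A) : Matrix (P × A) (P × A) ℂ :=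
  Matrix.of fun x y => U x.1 y.1 x.2 y.2

/-- The right rank `r`. -/
def rightRank {P A : Type*} [Fintype P] [Fintype A] (p : P → ZMod 2) (U : MPOTensor P A) : ℕ :=
  (rightMap p U).rank

/-- The left rank `ℓ`. -/
def leftRank {P A : Type*} [Fintype P] [Fintype A] (U : MPOTensor P A) : ℕ :=
  (leftMap U).rank

/-- The exponentiated fermionic index `√(r / ℓ)`. -/
def expIndex {P A : Type*} [Fintype P] [Fintype A] (p : P → ZMod 2) (U : MPOTensor P A) : ℝ :=
  Real.sqrt ((rightRank p U : ℝ) / (leftRank U : ℝ))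

/-! ### The Majorana shift -/

/-- The parity of the basis `|0⟩, |1⟩` of `ℂ^{1|1}`. -/
def modeParity : Fin 2 → ZMod 2 := fun n => ((n : ℕ) : ZMod 2)

/-- The tensor `M^{n,m} = i^m (σ^x)^{n+m} / √2` of the Majorana shift; both its physical and its
auxiliary space are `ℂ^{1|1}`. -/
def majorana : MPOTensor (Fin 2) (Fin 2) :=
  fun n m => (Complex.I ^ (m : ℕ) / (Real.sqrt 2 : ℂ)) •
    (!![0, 1; 1, 0] : Matrix (Fin 2) (Fin 2) ℂ) ^ ((n : ℕ) + (m : ℕ))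

/-- The parity on the local space `ℂ^{1|1} ⊗ 𝓨`, where the ancilla `𝓨` has basis `Y`. -/
def siteParity {Y : Type*} (y : Y → ZMod 2) : Fin 2 × Y → ZMod 2 := addParity modeParity y

/-- The tensor of the Majorana shift on `ℂ^{1|1}` with the identity on the ancilla. The unitary
operator on `N` sites is `abcOperator (siteParity y) (1 / √2) (majoranaShift Y) N`. -/
def majoranaShift (Y : Type*) [DecidableEq Y] : MPOTensor (Fin 2 × Y) (Fin 2) :=
  withAncilla Y majorana

/-- The tensor obtained by composing `U` with the Majorana shift. -/
def timesShift {Y A : Type*} [Fintype Y] [DecidableEq Y] (y : Y → ZMod 2)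
    (U : MPOTensor (Fin 2 × Y) A) : MPOTensor (Fin 2 × Y) (A × Fin 2) :=
  compose (siteParity y) modeParity U (majoranaShift Y)

end FMPU

end

/-! Fermionic signs are removed first. Multiplying each matrix on the right by the auxiliary parity
to the power of the incoming physical parity (`hat`) turns blocking into ordinary products
(`hat_block`) and composition into ordinary composition up to conjugation by a diagonal involution
(`hat_compose`). Both ranks become ranks of unsigned left maps, of the tensor or of its transpose
(`leftRank_eq`, `rightRank_eq`).

A rank is determined by a Gram matrix. For a left map followed by `F`, that Gram matrix is the row
vector `gramVec F` applied to the tensor of `V†V`. If the vector passes through the first part of a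
chain, producing a Kronecker delta, that part contributes only an identity factor, so the rank is
the dimension of that part times the rank of the remainder (`rank_leftMapF_plainCat`).

For the simple type I factor, `F` consists of all words of length `k`. Its vector is a multiple of
the maximally entangled vector times `Q = E ^ k`. Unitarity gives `tr E ^ N = 1`, so the idempotent
`Q` has rank one, and simplicity gives `Q S Q = δ Q` for words `S` of every length
(`IsSimpleData.collapses`). Hence the vector passes through any `r + k` sites followed by `k` more.
Canonical form makes `F` injective on the blocks with nonzero coefficient, so inserting `F` costs no
rank. For the shift, `F = 1` suffices: its right map is invertible, while on the left off-diagonal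
terms vanish only at the next site, which leaves rank `d ^ k`.

In the composition the invertible right map of the shift doubles the right rank of the type I
factor. On the left, the first `r + k` sites of the type I factor and the last `k` sites of the
shift drop out (`rank_leftMap_plainCompose_plainCat`). With `q = r + 2k` the right and left ranks
are `2 d ^ (r + k) r_k` and `d ^ (r + k) ℓ_k`, where `r_k` and `ℓ_k` belong to the type I block, so
the index is multiplied by `√2`. -/

noncomputable section

open scoped Kronecker ComplexOrder

namespace FMPU

/-! ### Ranks of matrices -/

section Rank

variable {l m n o : Type*} [Fintype l] [Fintype m] [Fintype n] [Fintype o]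

theorem exists_isUnit_mul_mul_eq_diagonal [DecidableEq m] (M : Matrix m m ℂ) :
    ∃ (V U : Matrix m m ℂ) (w : m → ℂ), IsUnit V.det ∧ IsUnit U.det ∧ V * M * U = diagonal w := by
  obtain ⟨V, U, e, hV, hU, h⟩ := Matrix.exists_rank_normal_form M
  refine ⟨V, U, (Sum.elim 1 0) ∘ e, (isUnit_iff_isUnit_det _).1 hV,
    (isUnit_iff_isUnit_det _).1 hU, ?_⟩
  rw [h, ← diagonal_one, ← diagonal_zero, fromBlocks_diagonal, submatrix_diagonal_equiv]
  rfl

/-- Invertible factors on either side do not change the rank, so both matrices may be taken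
diagonal, where rank counts nonzero entries. Rectangular matrices reduce to this case through their
Gram matrices. -/
theorem rank_kronecker_square [DecidableEq m] [DecidableEq n] (A : Matrix m m ℂ)
    (B : Matrix n n ℂ) : (A ⊗ₖ B).rank = A.rank * B.rank := by
  obtain ⟨V, U, w, hV, hU, h⟩ := exists_isUnit_mul_mul_eq_diagonal A
  obtain ⟨V', U', w', hV', hU', h'⟩ := exists_isUnit_mul_mul_eq_diagonal B
  have unit : ∀ {X : Matrix m m ℂ} {Y : Matrix n n ℂ}, IsUnit X.det → IsUnit Y.det →
      IsUnit (X ⊗ₖ Y).det := by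
    intro X Y hX hY
    rw [Matrix.det_kronecker]
    exact (hX.pow _).mul (hY.pow _)
  have hA : (V * A * U).rank = A.rank := by
    rw [rank_mul_eq_left_of_isUnit_det _ _ hU, rank_mul_eq_right_of_isUnit_det _ _ hV]
  have hB : (V' * B * U').rank = B.rank := by
    rw [rank_mul_eq_left_of_isUnit_det _ _ hU', rank_mul_eq_right_of_isUnit_det _ _ hV']
  have hAB : ((V * A * U) ⊗ₖ (V' * B * U')).rank = (A ⊗ₖ B).rank := by
    rw [mul_kronecker_mul, mul_kronecker_mul,
      rank_mul_eq_left_of_isUnit_det _ _ (unit hU hU'),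
      rank_mul_eq_right_of_isUnit_det _ _ (unit hV hV')]
  rw [← hAB, ← hA, ← hB, h, h', diagonal_kronecker_diagonal]
  classical
  rw [rank_diagonal, rank_diagonal, rank_diagonal, ← Fintype.card_prod]
  exact Fintype.card_congr ⟨fun x => (⟨x.1.1, left_ne_zero_of_mul x.2⟩,
    ⟨x.1.2, right_ne_zero_of_mul x.2⟩), fun x => ⟨(x.1.1, x.2.1), mul_ne_zero x.1.2 x.2.2⟩,
    fun _ => rfl, fun _ => rfl⟩

theorem rank_kronecker (A : Matrix l m ℂ) (B : Matrix n o ℂ) :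
    (A ⊗ₖ B).rank = A.rank * B.rank := by
  classical
  rw [← rank_conjTranspose_mul_self, conjTranspose_kronecker, ← mul_kronecker_mul,
    rank_kronecker_square, rank_conjTranspose_mul_self, rank_conjTranspose_mul_self]

/-- The Gram matrix of `A * C` involves `A` only through `Aᴴ * A`. This allows a long chain to be
replaced by a short one inside a product. -/
theorem rank_mul_eq_of_gram_eq {A : Matrix l n ℂ} {B : Matrix m n ℂ} (h : Aᴴ * A = Bᴴ * B)
    (C : Matrix n o ℂ) : (A * C).rank = (B * C).rank := by
  rw [← rank_conjTranspose_mul_self (A * C), ← rank_conjTranspose_mul_self (B * C),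
    conjTranspose_mul, conjTranspose_mul, Matrix.mul_assoc, ← Matrix.mul_assoc Aᴴ, h,
    Matrix.mul_assoc, Matrix.mul_assoc]

theorem rank_eq_of_gram_eq {A : Matrix l n ℂ} {B : Matrix m n ℂ} (h : Aᴴ * A = Bᴴ * B) :
    A.rank = B.rank := by
  rw [← rank_conjTranspose_mul_self A, ← rank_conjTranspose_mul_self B, h]

/-- Equal rank forces the ranges of `A * B` and `A` to coincide, so their images under `Y` coincide
as well. -/
theorem rank_mul_mul_eq_of_rank_eq {l m n o : Type*} [Fintype m] [Fintype n] [Fintype o]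
    {A : Matrix m n ℂ} {B : Matrix n o ℂ}
    (h : (A * B).rank = A.rank) (Y : Matrix l m ℂ) : (Y * (A * B)).rank = (Y * A).rank := by
  have hr : LinearMap.range (A * B).mulVecLin = LinearMap.range A.mulVecLin := by
    refine Submodule.eq_of_le_of_finrank_eq ?_ h
    rw [mulVecLin_mul]
    exact LinearMap.range_comp_le_range _ _
  rw [Matrix.rank, Matrix.rank, mulVecLin_mul, mulVecLin_mul Y A, LinearMap.range_comp, hr,
    LinearMap.range_comp]

theorem rank_eq_of_mulVec_eq_zero_iff {l m n : Type*} [Fintype n] {A : Matrix l n ℂ} {B : Matrix m n ℂ}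
    (h : ∀ z, A *ᵥ z = 0 ↔ B *ᵥ z = 0) : A.rank = B.rank := by
  have hk : LinearMap.ker A.mulVecLin = LinearMap.ker B.mulVecLin := by
    ext z
    simpa using h z
  have h1 := A.mulVecLin.finrank_range_add_finrank_ker
  have h2 := B.mulVecLin.finrank_range_add_finrank_ker
  rw [hk] at h1
  simp only [Matrix.rank]
  omega

/-- The trace of a projection is the dimension of its range. -/
theorem exists_eq_vecMulVec_of_idempotent [DecidableEq n] {P : Matrix n n ℂ} (h : P * P = P)
    (ht : P.trace = 1) : ∃ u v : n → ℂ, P = vecMulVec u v := by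
  have hi : IsIdempotentElem (toLin' P) := by
    exact (Matrix.toLin'_mul P P).symm.trans (congrArg toLin' h)
  have h1 : Module.finrank ℂ (LinearMap.range (toLin' P)) = 1 := by
    have := (LinearMap.IsIdempotentElem.isProj_range _ hi).trace
    rw [Matrix.trace_toLin'_eq, ht] at this
    exact_mod_cast this.symm
  obtain ⟨u, hu, hu'⟩ := finrank_eq_one_iff'.1 h1
  choose c hc using fun j => hu' ⟨toLin' P (Pi.single j 1), LinearMap.mem_range_self _ _⟩
  refine ⟨u, c, ?_⟩
  ext i j
  have := congrArg (fun x : LinearMap.range (toLin' P) => (x : n → ℂ) i) (hc j)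
  simp at this
  rw [vecMulVec_apply, ← this, mul_comm]

end Rank

/-! ### Signs -/

@[simp] theorem sgn_zero : sgn 0 = 1 := by simp [sgn]

@[simp] theorem sgn_one : sgn 1 = -1 := by simp [sgn]

theorem zmod_two_cases (a : ZMod 2) : a = 0 ∨ a = 1 := by
  decide +revert

theorem sgn_add (a b : ZMod 2) : sgn (a + b) = sgn a * sgn b := by
  rcases zmod_two_cases a with rfl | rfl <;> rcases zmod_two_cases b with rfl | rfl <;>
    simp [CharTwo.add_self_eq_zero]

@[simp] theorem sgn_mul_self (a : ZMod 2) : sgn a * sgn a = 1 := by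
  rcases zmod_two_cases a with rfl | rfl <;> simp

@[simp] theorem conj_sgn (a : ZMod 2) : (starRingEnd ℂ) (sgn a) = sgn a := by
  rcases zmod_two_cases a with rfl | rfl <;> simp

@[simp] theorem star_sgn (a : ZMod 2) : star (sgn a) = sgn a := conj_sgn a

theorem sgn_ne_zero (a : ZMod 2) : sgn a ≠ 0 := by
  rcases zmod_two_cases a with rfl | rfl <;> simp

theorem sgn_sum {ι : Type*} (s : Finset ι) (f : ι → ZMod 2) :
    sgn (∑ i ∈ s, f i) = ∏ i ∈ s, sgn (f i) := by
  classical
  induction s using Finset.induction_on with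
  | empty => simp
  | insert i s hi ih => rw [Finset.sum_insert hi, Finset.prod_insert hi, sgn_add, ih]

/-! ### Products of families of matrices -/

theorem prod_ofFn_sum {R X : Type*} [Semiring R] [Fintype X] {k : ℕ} (F : Fin k → X → R) :
    (List.ofFn fun j => ∑ x, F j x).prod =
      ∑ w : Fin k → X, (List.ofFn fun j => F j (w j)).prod := by
  induction k with
  | zero => simp
  | succ k ih =>
    rw [List.ofFn_succ, List.prod_cons, ih, Finset.sum_mul_sum, ← Fintype.sum_prod_type'
      (f := fun (i : X) (j : Fin k → X) => F 0 i * (List.ofFn fun l => F l.succ (j l)).prod)]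
    refine Fintype.sum_equiv (Fin.consEquiv fun _ => X) _ _ fun x => ?_
    simp [List.ofFn_succ, Fin.consEquiv]

theorem prod_ofFn_kronecker {A B : Type*} [Fintype A] [DecidableEq A] [Fintype B] [DecidableEq B]
    {k : ℕ} (X : Fin k → Matrix A A ℂ) (Y : Fin k → Matrix B B ℂ) :
    (List.ofFn fun j => X j ⊗ₖ Y j).prod = (List.ofFn X).prod ⊗ₖ (List.ofFn Y).prod := by
  induction k with
  | zero => simp
  | succ k ih =>
    simp only [List.ofFn_succ, List.prod_cons, ih, mul_kronecker_mul]

/-! ### The tensors without signs -/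

section Tensor

variable {P A B : Type*}

/-- The tensor in which the incoming physical index carries the auxiliary parity operator. The
fermionic signs of all operations disappear in terms of it. -/
def hat (p : P → ZMod 2) (a : A → ZMod 2) (U : MPOTensor P A) : MPOTensor P A :=
  fun n m => Matrix.of fun α β => sgn (p m * a β) * U n m α β

/-- Blocking without signs. -/
def plainBlock [Fintype A] [DecidableEq A] (U : MPOTensor P A) (k : ℕ) : MPOTensor (Fin k → P) A :=
  fun n m => (List.ofFn fun j => U (n j) (m j)).prod

/-- Composition without signs. -/
def plainCompose [Fintype P] (U : MPOTensor P A) (V : MPOTensor P B) : MPOTensor P (A × B) :=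
  fun k i => ∑ j, U k j ⊗ₖ V j i

/-- The tensor of the adjoint operator, without signs. -/
def adj (V : MPOTensor P A) : MPOTensor P A := fun n m => (V m n).map star

/-- The tensor of `V†V`, without signs. -/
def square [Fintype P] (V : MPOTensor P A) : MPOTensor P (A × A) := plainCompose (adj V) V

theorem hat_apply (p : P → ZMod 2) (a : A → ZMod 2) (U : MPOTensor P A) (n m : P) (α β : A) :
    hat p a U n m α β = sgn (p m * a β) * U n m α β := rfl

theorem hat_injective (p : P → ZMod 2) (a : A → ZMod 2) :
    Function.Injective (hat p a : MPOTensor P A → MPOTensor P A) := by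
  intro U V h
  funext n m
  ext α β
  have := congrFun (congrFun (congrFun (congrFun h n) m) α) β
  exact mul_left_cancel₀ (sgn_ne_zero _) this

theorem IsEven.hat {p : P → ZMod 2} {a : A → ZMod 2} {U : MPOTensor P A} (h : IsEven p a U) :
    IsEven p a (hat p a U) := fun n m α β hne => h n m α β (right_ne_zero_of_mul hne)

theorem plainBlock_succ [Fintype A] [DecidableEq A] (U : MPOTensor P A) (k : ℕ)
    (n m : Fin (k + 1) → P) :
    plainBlock U (k + 1) n m =
      U (n 0) (m 0) * plainBlock U k (fun i => n i.succ) (fun i => m i.succ) := by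
  simp [plainBlock, List.ofFn_succ]

theorem plainBlock_append [Fintype A] [DecidableEq A] (U : MPOTensor P A) (h k : ℕ)
    (n m : Fin h → P) (n' m' : Fin k → P) :
    plainBlock U (h + k) (Fin.append n n') (Fin.append m m') =
      plainBlock U h n m * plainBlock U k n' m' := by
  simp [plainBlock, List.ofFn_add]

theorem chainParity_succ (p : P → ZMod 2) (k : ℕ) (n : Fin (k + 1) → P) :
    chainParity p (k + 1) n = p (n 0) + chainParity p k (fun i => n i.succ) := by
  simp [chainParity, Fin.sum_univ_succ]

/-- The sign picked up by the matrices of a blocked tensor. -/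
def blockSign (p : P → ZMod 2) (k : ℕ) (n m : Fin k → P) : ℂ :=
  ∏ j, ∏ i ∈ Finset.Iio j, sgn (p (m i) * (p (n j) + p (m j)))

theorem blockSign_succ (p : P → ZMod 2) (k : ℕ) (n m : Fin (k + 1) → P) :
    blockSign p (k + 1) n m =
      sgn (p (m 0) * (chainParity p k (fun i => n i.succ) + chainParity p k (fun i => m i.succ))) *
        blockSign p k (fun i => n i.succ) (fun i => m i.succ) := by
  have h : ∀ {k : ℕ} (j : Fin k) (f : Fin k → ℂ),
      ∏ i ∈ Finset.Iio j, f i = ∏ i, if i < j then f i else 1 := by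
    intro k j f
    rw [← Finset.prod_filter]
    congr 1
    ext
    simp
  simp only [blockSign, h, Fin.prod_univ_succ, Fin.not_lt_zero, if_false, Finset.prod_const_one,
    Fin.succ_pos, if_true, Fin.succ_lt_succ_iff, one_mul, Finset.prod_mul_distrib]
  congr 1
  rw [chainParity, chainParity, ← Finset.sum_add_distrib, Finset.mul_sum, sgn_sum]

theorem blockSign_sq (p : P → ZMod 2) (k : ℕ) (n m : Fin k → P) :
    blockSign p k n m * blockSign p k n m = 1 := by
  simp [blockSign, ← Finset.prod_mul_distrib]

theorem star_blockSign (p : P → ZMod 2) (k : ℕ) (n m : Fin k → P) :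
    star (blockSign p k n m) = blockSign p k n m := by
  simp [blockSign]

theorem block_eq [Fintype A] [DecidableEq A] (p : P → ZMod 2) (U : MPOTensor P A) (k : ℕ)
    (n m : Fin k → P) : block p U k n m = blockSign p k n m • plainBlock U k n m := rfl

theorem IsEven.plainBlock [Fintype A] [DecidableEq A] {p : P → ZMod 2} {a : A → ZMod 2}
    {U : MPOTensor P A} (h : IsEven p a U) (k : ℕ) :
    IsEven (chainParity p k) a (plainBlock U k) := by
  induction k with
  | zero =>
    intro n m α β hne
    have : α = β := by
      by_contra hαβ
      exact hne (by simp [FMPU.plainBlock, one_apply_ne hαβ])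
    subst this
    simp [chainParity, CharTwo.add_self_eq_zero]
  | succ k ih =>
    intro n m α β hne
    rw [plainBlock_succ, mul_apply] at hne
    obtain ⟨x, -, hx⟩ := Finset.exists_ne_zero_of_sum_ne_zero hne
    have h1 := h _ _ _ _ (left_ne_zero_of_mul hx)
    have h2 := ih _ _ _ _ (right_ne_zero_of_mul hx)
    rw [chainParity_succ, chainParity_succ]
    generalize chainParity p k _ = u at *
    generalize chainParity p k _ = v at *
    generalize p (n 0) = s at *
    generalize p (m 0) = t at *
    generalize a x = b at *
    generalize a α = c at *
    generalize a β = d at *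
    clear hx hne ih h
    decide +revert

theorem IsEven.block [Fintype A] [DecidableEq A] {p : P → ZMod 2} {a : A → ZMod 2}
    {U : MPOTensor P A} (h : IsEven p a U) (k : ℕ) :
    IsEven (chainParity p k) a (block p U k) :=
  fun n m α β hne => h.plainBlock k n m α β (right_ne_zero_of_mul hne)

/-- Evenness of the tail word replaces its total physical parity by the sum of the parities of its
two auxiliary indices. The sign for moving the first incoming index past the tail then lives on the
bond between them, as the `hat` sign of the first site. -/
theorem hat_block [Fintype A] [DecidableEq A] {p : P → ZMod 2} {a : A → ZMod 2}
    {U : MPOTensor P A} (h : IsEven p a U) (k : ℕ) :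
    hat (chainParity p k) a (block p U k) = plainBlock (hat p a U) k := by
  induction k with
  | zero =>
    funext n m
    ext α β
    simp [hat_apply, block_eq, blockSign, plainBlock, chainParity]
  | succ k ih =>
    funext n m
    ext α β
    rw [plainBlock_succ, ← ih, hat_apply, block_eq, plainBlock_succ, Matrix.smul_apply, mul_apply,
      mul_apply, blockSign_succ, smul_eq_mul, Finset.mul_sum, Finset.mul_sum]
    refine Finset.sum_congr rfl fun x _ => ?_
    rw [hat_apply, hat_apply, block_eq, Matrix.smul_apply, smul_eq_mul, chainParity_succ]
    set X := FMPU.plainBlock U k (fun i => n i.succ) (fun i => m i.succ) x β with hX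
    by_cases h0 : X = 0
    · simp [h0]
    have h2 := h.plainBlock k _ _ _ _ h0
    generalize chainParity p k _ = u at *
    generalize chainParity p k _ = v at *
    have key : sgn ((p (m 0) + v) * a β) * sgn (p (m 0) * (u + v)) =
        sgn (p (m 0) * a x) * sgn (v * a β) := by
      rw [← sgn_add, ← sgn_add]
      congr 1
      generalize p (m 0) = t at *
      generalize a x = b at *
      generalize a β = d at *
      clear ih h hX h0
      clear X
      decide +revert
    linear_combination (blockSign p k (fun i => n i.succ) (fun i => m i.succ) *
      U (n 0) (m 0) α x * X) * key

theorem plainCompose_apply [Fintype P] (U : MPOTensor P A) (V : MPOTensor P B) (k i : P)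
    (x y : A × B) : plainCompose U V k i x y = ∑ j, U k j x.1 y.1 * V j i x.2 y.2 := by
  simp [plainCompose, Matrix.sum_apply]

theorem plainBlock_plainCompose [Fintype P] [Fintype A] [DecidableEq A] [Fintype B]
    [DecidableEq B] (U : MPOTensor P A) (V : MPOTensor P B) (k : ℕ) :
    plainBlock (plainCompose U V) k = plainCompose (plainBlock U k) (plainBlock V k) := by
  funext n m
  simp only [plainBlock, plainCompose]
  rw [prod_ofFn_sum]
  exact Finset.sum_congr rfl fun w _ => prod_ofFn_kronecker _ _

theorem plainBlock_adj [Fintype A] [DecidableEq A] (V : MPOTensor P A) (k : ℕ) :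
    plainBlock (adj V) k = adj (plainBlock V k) := by
  funext n m
  have := (List.prod_hom (List.ofFn fun j => V (m j) (n j))
    (RingHom.mapMatrix (starRingEnd ℂ) : Matrix A A ℂ →+* Matrix A A ℂ))
  rw [List.map_ofFn] at this
  exact this

theorem plainBlock_square [Fintype P] [Fintype A] [DecidableEq A] (V : MPOTensor P A) (k : ℕ) :
    plainBlock (square V) k = square (plainBlock V k) := by
  rw [square, plainBlock_plainCompose, plainBlock_adj, square]

/-- The sign relating the two auxiliary factors of a composition. -/
def gauge [DecidableEq A] [DecidableEq B] (a : A → ZMod 2) (b : B → ZMod 2) :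
    Matrix (A × B) (A × B) ℂ :=
  diagonal fun x => sgn (a x.1 * b x.2)

theorem gauge_mul_gauge [Fintype A] [Fintype B] [DecidableEq A] [DecidableEq B] (a : A → ZMod 2)
    (b : B → ZMod 2) : gauge a b * gauge a b = 1 := by
  simp [gauge]

theorem IsEven.compose [Fintype P] {p : P → ZMod 2} {a : A → ZMod 2} {b : B → ZMod 2}
    {U : MPOTensor P A} {V : MPOTensor P B} (hU : IsEven p a U) (hV : IsEven p b V) :
    IsEven p (addParity a b) (compose p b U V) := by
  intro k i x y hne
  obtain ⟨j, -, hj⟩ := Finset.exists_ne_zero_of_sum_ne_zero hne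
  have h1 := hU _ _ _ _ (right_ne_zero_of_mul (left_ne_zero_of_mul hj))
  have h2 := hV _ _ _ _ (right_ne_zero_of_mul hj)
  simp only [addParity]
  linear_combination h1 + h2 - (CharTwo.add_self_eq_zero (p j))

/-- By evenness the composition sign splits into a function of the left and a function of the right
auxiliary pair. Since `gauge` is an involution, it cancels between neighbouring sites and leaves
ranks unchanged. -/
theorem hat_compose [Fintype P] [Fintype A] [Fintype B] [DecidableEq A] [DecidableEq B]
    {p : P → ZMod 2} {a : A → ZMod 2} {b : B → ZMod 2}
    {U : MPOTensor P A} {V : MPOTensor P B} (hU : IsEven p a U) (hV : IsEven p b V) (k i : P) :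
    hat p (addParity a b) (compose p b U V) k i =
      gauge a b * plainCompose (hat p a U) (hat p b V) k i * gauge a b := by
  ext x y
  rw [gauge, mul_diagonal, diagonal_mul, plainCompose_apply, hat_apply, compose, of_apply,
    Finset.mul_sum, Finset.mul_sum, Finset.sum_mul]
  refine Finset.sum_congr rfl fun j _ => ?_
  rw [hat_apply, hat_apply]
  by_cases h0 : U k j x.1 y.1 * V j i x.2 y.2 = 0
  · linear_combination (sgn (p i * addParity a b y) * sgn (b x.2 * (p k + p j)) -
      sgn (a x.1 * b x.2) * sgn (p j * a y.1) * sgn (p i * b y.2) * sgn (a y.1 * b y.2)) * h0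
  have h1 := hU _ _ _ _ (left_ne_zero_of_mul h0)
  have h2 := hV _ _ _ _ (right_ne_zero_of_mul h0)
  have key : sgn (p i * addParity a b y) * sgn (b x.2 * (p k + p j)) =
      sgn (a x.1 * b x.2) * sgn (p j * a y.1) * sgn (p i * b y.2) * sgn (a y.1 * b y.2) := by
    simp only [← sgn_add, addParity]
    congr 1
    generalize p i = i at *
    generalize p j = j at *
    generalize p k = k at *
    generalize a x.1 = c at *
    generalize a y.1 = d at *
    generalize b x.2 = e at *
    generalize b y.2 = f at *
    clear h0 hU hV
    decide +revert
  linear_combination (U k j x.1 y.1 * V j i x.2 y.2) * key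

theorem plainBlock_conj [Fintype A] [DecidableEq A] {G : Matrix A A ℂ} (hG : G * G = 1)
    (V W : MPOTensor P A) (h : ∀ n m, W n m = G * V n m * G) (k : ℕ) (n m : Fin k → P) :
    plainBlock W k n m = G * plainBlock V k n m * G := by
  induction k with
  | zero => simp [plainBlock, hG]
  | succ k ih =>
    rw [plainBlock_succ, plainBlock_succ, ih, h]
    simp only [Matrix.mul_assoc]
    rw [← Matrix.mul_assoc G G, hG, Matrix.one_mul]

theorem block_compose [Fintype P] [Fintype A] [Fintype B] [DecidableEq A] [DecidableEq B]
    {p : P → ZMod 2} {a : A → ZMod 2} {b : B → ZMod 2}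
    {U : MPOTensor P A} {V : MPOTensor P B} (hU : IsEven p a U) (hV : IsEven p b V) (k : ℕ) :
    block p (compose p b U V) k = compose (chainParity p k) b (block p U k) (block p V k) := by
  apply hat_injective (chainParity p k) (addParity a b)
  funext n m
  rw [hat_block (hU.compose hV), hat_compose (hU.block k) (hV.block k), hat_block hU,
    hat_block hV, ← plainBlock_plainCompose]
  exact plainBlock_conj (gauge_mul_gauge a b) _ _ (hat_compose hU hV) k n m

end Tensor

/-! ### The generated operators -/

section Operator

variable {P A B : Type*}

/-- In an increasing product the later sites act first. When site `j` acts, every earlier site still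
carries its input value, so all signs can be read from `t`. -/
theorem siteOp_prod_apply [Fintype P] [DecidableEq P] (p : P → ZMod 2) {N : ℕ} (n m : Fin N → P)
    (l : List (Fin N)) (hl : l.Pairwise (· < ·)) (s t : Fin N → P) :
    (l.map fun j => siteOp p j (n j) (m j)).prod s t =
      if (∀ j ∈ l, t j = m j ∧ s j = n j) ∧ ∀ j ∉ l, s j = t j then
        (l.map fun j => ∏ i ∈ Finset.Iio j, sgn ((p (n j) + p (m j)) * p (t i))).prod
      else 0 := by
  induction l generalizing s with
  | nil =>
    simp [one_apply, funext_iff]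
  | cons j l ih =>
    rw [List.pairwise_cons] at hl
    have hj : j ∉ l := fun h => lt_irrefl _ (hl.1 j h)
    -- The only intermediate state that can contribute is the output with site `j` put back to its
    -- input value.
    rw [List.map_cons, List.prod_cons, mul_apply, Finset.sum_eq_single (Function.update s j (t j))]
    · rw [ih hl.2]
      have hiff : ((∀ i ∈ l, t i = m i ∧ Function.update s j (t j) i = n i) ∧
            ∀ i ∉ l, Function.update s j (t j) i = t i) ∧ (t j = m j ∧ s j = n j) ↔
          (∀ i ∈ j :: l, t i = m i ∧ s i = n i) ∧ ∀ i ∉ j :: l, s i = t i := by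
        constructor
        · rintro ⟨⟨h1, h2⟩, h3⟩
          refine ⟨fun i hi => ?_, fun i hi => ?_⟩
          · rcases List.mem_cons.1 hi with rfl | hi
            · exact h3
            · have hij : i ≠ j := fun h => hj (h ▸ hi)
              simpa [hij] using h1 i hi
          · rw [List.mem_cons, not_or] at hi
            simpa [hi.1] using h2 i hi.2
        · rintro ⟨h1, h2⟩
          refine ⟨⟨fun i hi => ?_, fun i hi => ?_⟩, h1 j (by simp)⟩
          · have hij : i ≠ j := fun h => hj (h ▸ hi)
            simpa [hij] using h1 i (by simp [hi])
          · by_cases hij : i = j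
            · subst hij; simp
            · simpa [hij] using h2 i (by simp [hi, hij])
      have hs : s = Function.update (Function.update s j (t j)) j (n j) ↔ s j = n j := by
        rw [Function.update_idem]
        constructor
        · intro h
          rw [h]
          simp
        · intro h
          rw [← h, Function.update_eq_self]
      by_cases hc : (∀ i ∈ j :: l, t i = m i ∧ s i = n i) ∧ ∀ i ∉ j :: l, s i = t i
      · have hc' := hiff.2 hc
        rw [if_pos hc, if_pos hc'.1, siteOp, of_apply,
          if_pos ⟨(Function.update_self _ _ _).trans hc'.2.1, hs.2 hc'.2.2⟩,
          List.map_cons, List.prod_cons]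
        congr 1
        refine Finset.prod_congr rfl fun i hi => ?_
        rw [Finset.mem_Iio] at hi
        rw [hc'.1.2 i fun h => absurd (hl.1 i h) hi.not_gt]
      · rw [if_neg hc]
        rw [← hiff, not_and_or] at hc
        rcases hc with hc | hc
        · rw [if_neg hc, mul_zero]
        · rw [siteOp, of_apply, if_neg fun h =>
            hc ⟨(Function.update_self _ _ _).symm.trans h.1, hs.1 h.2⟩, zero_mul]
    · intro u _ hu
      rw [ih hl.2, siteOp, of_apply]
      by_cases h1 : u j = m j ∧ s = Function.update u j (n j)
      · by_cases h2 : (∀ j ∈ l, t j = m j ∧ u j = n j) ∧ ∀ j ∉ l, u j = t j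
        · refine absurd ?_ hu
          rw [h1.2, Function.update_idem, ← h2.2 j hj, Function.update_eq_self]
        · rw [if_neg h2, mul_zero]
      · rw [if_neg h1, zero_mul]
    · simp

theorem siteOp_prod_ofFn_apply [Fintype P] [DecidableEq P] (p : P → ZMod 2) {N : ℕ}
    (n m s t : Fin N → P) :
    (List.ofFn fun j => siteOp p j (n j) (m j)).prod s t =
      if t = m ∧ s = n then blockSign p N n m else 0 := by
  rw [List.ofFn_eq_map, siteOp_prod_apply p n m _ (List.pairwise_lt_finRange N)]
  by_cases h : t = m ∧ s = n
  · rw [if_pos h, if_pos (by simp [h.1, h.2]), h.1, blockSign, ← List.ofFn_eq_map, List.prod_ofFn]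
    simp only [mul_comm]
  · rw [if_neg h, if_neg]
    rintro ⟨h', -⟩
    exact h ⟨funext fun j => (h' j (by simp)).1, funext fun j => (h' j (by simp)).2⟩

theorem abcOperator_apply [Fintype P] [DecidableEq P] [Fintype A] [DecidableEq A]
    (p : P → ZMod 2) (c : ℂ) (U : MPOTensor P A) (N : ℕ) (s t : Fin N → P) :
    abcOperator p c U N s t = c * (block p U N s t).trace := by
  simp only [abcOperator, Matrix.sum_apply, Matrix.smul_apply, siteOp_prod_ofFn_apply]
  rw [Finset.sum_eq_single s, Finset.sum_eq_single t]
  · rw [if_pos ⟨rfl, rfl⟩, block_eq, trace_smul, smul_eq_mul, smul_eq_mul, plainBlock]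
    ring
  · intro m _ hm
    rw [if_neg fun h => hm h.1.symm, smul_zero]
  · simp
  · intro n _ hn
    exact Finset.sum_eq_zero fun m _ => by rw [if_neg fun h => hn h.2.symm, smul_zero]
  · simp

/-- On the diagonal the two auxiliary parities of `U` agree, so evenness leaves only terms with `p k
+ p j = 0`, whose sign is trivial. -/
theorem trace_compose [Fintype P] [Fintype A] [Fintype B] {p : P → ZMod 2} {a : A → ZMod 2}
    (b : B → ZMod 2) {U : MPOTensor P A} (hU : IsEven p a U) (V : MPOTensor P B) (k i : P) :
    (compose p b U V k i).trace = ∑ j, (U k j).trace * (V j i).trace := by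
  simp only [Matrix.trace, diag_apply, compose, of_apply]
  rw [Finset.sum_comm]
  refine Finset.sum_congr rfl fun j _ => ?_
  rw [Finset.sum_mul_sum, ← Fintype.sum_prod_type']
  refine Finset.sum_congr rfl fun x _ => ?_
  by_cases h0 : U k j x.1 x.1 = 0
  · simp [h0]
  have h1 := hU _ _ _ _ h0
  have h2 : p k + p j = 0 := by
    linear_combination h1 - CharTwo.add_self_eq_zero (a x.1)
  rw [h2, mul_zero, sgn_zero, one_mul]

theorem abcOperator_compose [Fintype P] [DecidableEq P] [Fintype A] [DecidableEq A] [Fintype B]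
    [DecidableEq B] {p : P → ZMod 2} {a : A → ZMod 2} {b : B → ZMod 2} {U : MPOTensor P A}
    {V : MPOTensor P B} (hU : IsEven p a U) (hV : IsEven p b V) (c c' : ℂ) (N : ℕ) :
    abcOperator p (c * c') (compose p b U V) N = abcOperator p c U N * abcOperator p c' V N := by
  ext s t
  rw [abcOperator_apply, block_compose hU hV, trace_compose b (hU.block N), mul_apply,
    Finset.mul_sum]
  refine Finset.sum_congr rfl fun r _ => ?_
  rw [abcOperator_apply, abcOperator_apply]
  ring

/-! ### Transfer matrices -/

theorem transferMatrix_eq_sum [Fintype P] (U : MPOTensor P A) :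
    transferMatrix U = ∑ x : P × P, ((U x.1 x.2).map star) ⊗ₖ U x.1 x.2 := by
  ext x y
  rw [Fintype.sum_prod_type]
  simp [transferMatrix, Matrix.sum_apply]

theorem transferMatrix_plainBlock [Fintype P] [Fintype A] [DecidableEq A] (U : MPOTensor P A)
    (k : ℕ) : transferMatrix (plainBlock U k) = transferMatrix U ^ k := by
  have h := prod_ofFn_sum (k := k) fun _ (x : P × P) => ((U x.1 x.2).map star) ⊗ₖ U x.1 x.2
  rw [← transferMatrix_eq_sum, List.ofFn_const, List.prod_replicate] at h
  rw [h, transferMatrix_eq_sum]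
  refine (Fintype.sum_equiv (Equiv.arrowProdEquivProdArrow _ _ _) _ _ fun w => ?_).symm
  rw [prod_ofFn_kronecker]
  congr 1
  exact congrFun (congrFun (plainBlock_adj U k) fun j => (w j).2) fun j => (w j).1

theorem transferMatrix_block [Fintype P] [Fintype A] [DecidableEq A] (p : P → ZMod 2)
    (U : MPOTensor P A) (k : ℕ) : transferMatrix (block p U k) = transferMatrix U ^ k := by
  rw [← transferMatrix_plainBlock]
  ext x y
  simp only [transferMatrix, of_apply]
  refine Finset.sum_congr rfl fun n _ => Finset.sum_congr rfl fun m _ => ?_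
  rw [block_eq, Matrix.smul_apply, Matrix.smul_apply, smul_eq_mul, smul_eq_mul, star_mul',
    star_blockSign]
  linear_combination (star (plainBlock U k n m x.1 y.1) * plainBlock U k n m x.2 y.2) *
    blockSign_sq p k n m

theorem normTransferMatrix_block [Fintype P] [Fintype A] [DecidableEq A] (p : P → ZMod 2)
    (U : MPOTensor P A) (k : ℕ) : normTransferMatrix (block p U k) = normTransferMatrix U ^ k := by
  simp [normTransferMatrix, transferMatrix_block, smul_pow]

theorem trace_transferMatrix [Fintype P] [Fintype A] (U : MPOTensor P A) :
    (transferMatrix U).trace = ∑ n, ∑ m, star (U n m).trace * (U n m).trace := by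
  rw [transferMatrix_eq_sum, trace_sum, Fintype.sum_prod_type]
  refine Finset.sum_congr rfl fun n _ => Finset.sum_congr rfl fun m _ => ?_
  rw [trace_kronecker]
  congr 1
  simp [Matrix.trace]

/-- The trace of the unitarity relation says that the squared moduli of the entries sum to `d ^ N`.
The boundary phase has modulus one, and that sum is the trace of the `N`-th power of the
unnormalized transfer matrix. -/
theorem trace_normTransferMatrix_pow [Fintype P] [DecidableEq P] [Nonempty P] [Fintype A]
    [DecidableEq A] {p : P → ZMod 2} {a : A → ZMod 2} {U : MPOTensor P A}
    (hU : GeneratesTypeI p a U) (N : ℕ) (hN : 1 ≤ N) : (normTransferMatrix U ^ N).trace = 1 := by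
  obtain ⟨-, θ, h⟩ := hU
  have h1 := congrArg Matrix.trace (mem_unitaryGroup_iff'.1 (h N hN))
  have hc : star (Complex.exp (θ * Complex.I)) * Complex.exp (θ * Complex.I) = 1 := by
    rw [Complex.star_def, ← Complex.exp_conj, ← Complex.exp_add]
    simp
  have hd : (Fintype.card P : ℂ) ≠ 0 := Nat.cast_ne_zero.2 Fintype.card_ne_zero
  rw [normTransferMatrix, smul_pow, trace_smul, ← transferMatrix_block p, trace_transferMatrix,
    Finset.sum_comm]
  rw [trace_one, Matrix.trace] at h1
  simp only [diag_apply, mul_apply, star_apply, abcOperator_apply, star_mul'] at h1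
  have h2 : ∀ i j : Fin N → P, star (Complex.exp (θ * Complex.I)) * star (block p U N i j).trace *
      (Complex.exp (θ * Complex.I) * (block p U N i j).trace) =
      star (block p U N i j).trace * (block p U N i j).trace := by
    intro i j
    linear_combination (star (block p U N i j).trace * (block p U N i j).trace) * hc
  simp only [h2] at h1
  rw [h1, Fintype.card_fun, Fintype.card_fin, smul_eq_mul, Nat.cast_pow, ← mul_pow,
    inv_mul_cancel₀ hd, one_pow]

end Operator

/-! ### Ranks of the maps attached to a tensor -/

section Ranks

variable {P P₁ P₂ A B I : Type*}

/-- The map `|m⟩ ⊗ |β) ↦ (F V^{n,m})_{i,β} |n⟩ ⊗ |i)`. -/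
def leftMapF [Fintype A] (F : Matrix I A ℂ) (V : MPOTensor P A) : Matrix (P × I) (P × A) ℂ :=
  Matrix.of fun x y => (F * V x.1 y.1) x.2 y.2

/-- The vector `∑_i conj(F i) ⊗ F i`. -/
def gramVec [Fintype I] (F : Matrix I A ℂ) : A × A → ℂ := fun x => ∑ i, star (F i x.1) * F i x.2

/-- The tensor with transposed matrices. -/
def flip (V : MPOTensor P A) : MPOTensor P A := fun n m => (V n m)ᵀ

/-- The concatenation of two tensors, without signs. -/
def plainCat [Fintype A] (V : MPOTensor P₁ A) (W : MPOTensor P₂ A) : MPOTensor (P₁ × P₂) A :=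
  fun n m => V n.1 m.1 * W n.2 m.2

theorem leftMapF_one [Fintype A] [DecidableEq A] (V : MPOTensor P A) :
    leftMapF 1 V = leftMap V := by
  ext x y
  simp [leftMapF, leftMap]

theorem gram_leftMapF [Fintype P] [Fintype A] [Fintype I] (F : Matrix I A ℂ)
    (V : MPOTensor P A) : (leftMapF F V)ᴴ * leftMapF F V =
      Matrix.of fun x y => (gramVec F ᵥ* square V x.1 y.1) (x.2, y.2) := by
  ext x y
  rw [mul_apply, Fintype.sum_prod_type, of_apply, vecMul, dotProduct, Fintype.sum_prod_type]
  simp only [conjTranspose_apply, leftMapF, of_apply, gramVec, square, plainCompose_apply, adj,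
    map_apply, mul_apply, star_sum, star_mul', Finset.sum_mul_sum]
  rw [Finset.sum_comm]
  calc _ = ∑ i, ∑ α, ∑ j, ∑ γ, star (F i α) * star (V j x.1 α x.2) * (F i γ * V j y.1 γ y.2) :=
        Finset.sum_congr rfl fun i _ => Finset.sum_comm
    _ = ∑ α, ∑ i, ∑ γ, ∑ j, star (F i α) * star (V j x.1 α x.2) * (F i γ * V j y.1 γ y.2) := by
        rw [Finset.sum_comm]
        exact Finset.sum_congr rfl fun α _ => Finset.sum_congr rfl fun i _ => Finset.sum_comm
    _ = ∑ α, ∑ γ, ∑ i, ∑ j, star (F i α) * star (V j x.1 α x.2) * (F i γ * V j y.1 γ y.2) :=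
        Finset.sum_congr rfl fun α _ => Finset.sum_comm
    _ = _ := Finset.sum_congr rfl fun α _ => Finset.sum_congr rfl fun γ _ =>
        Finset.sum_congr rfl fun i _ => Finset.sum_congr rfl fun j _ => by ring

theorem square_plainCat [Fintype P₁] [Fintype P₂] [Fintype A] (V : MPOTensor P₁ A)
    (W : MPOTensor P₂ A) (n m : P₁ × P₂) :
    square (plainCat V W) n m = square V n.1 m.1 * square W n.2 m.2 := by
  simp only [square, plainCompose, plainCat, Finset.sum_mul_sum, Fintype.sum_prod_type]
  refine Finset.sum_congr rfl fun i _ => Finset.sum_congr rfl fun j _ => ?_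
  rw [← mul_kronecker_mul]
  congr 1
  ext α β
  simp [adj, mul_apply, plainCat]

theorem square_flip [Fintype P] (V : MPOTensor P A) (n m : P) :
    square (flip V) n m = (square V n m)ᵀ := by
  ext x y
  simp [square, plainCompose_apply, adj, flip]

theorem plainCompose_flip [Fintype P] (V : MPOTensor P A) (W : MPOTensor P B) :
    plainCompose (flip V) (flip W) = flip (plainCompose V W) := by
  funext n m
  ext x y
  simp [plainCompose_apply, flip]

/-- If the vector of `F` passes to the right, the left map of a concatenation has the Gram matrix
of the left map of its last part. -/
theorem gram_leftMapF_plainCat [Fintype P₁] [DecidableEq P₁] [Fintype P₂] [Fintype A] [Fintype I]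
    {F : Matrix I A ℂ} {V : MPOTensor P₁ A} {W : MPOTensor P₂ A}
    (h : ∀ n m n' m', gramVec F ᵥ* (square V n m * square W n' m') =
      if n = m then gramVec F ᵥ* square W n' m' else 0) (x y : (P₁ × P₂) × A) :
    ((leftMapF F (plainCat V W))ᴴ * leftMapF F (plainCat V W)) x y =
      if x.1.1 = y.1.1 then ((leftMapF F W)ᴴ * leftMapF F W) (x.1.2, x.2) (y.1.2, y.2) else 0 := by
  rw [gram_leftMapF, gram_leftMapF, of_apply, of_apply, square_plainCat, h]
  split_ifs <;> rfl

/-- The Gram matrix is that of `1 ⊗ₖ leftMapF F W`, up to reassociating tensor factors. -/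
theorem rank_leftMapF_plainCat [Fintype P₁] [DecidableEq P₁] [Fintype P₂] [Fintype A] [Fintype I]
    {F : Matrix I A ℂ} {V : MPOTensor P₁ A} {W : MPOTensor P₂ A}
    (h : ∀ n m n' m', gramVec F ᵥ* (square V n m * square W n' m') =
      if n = m then gramVec F ᵥ* square W n' m' else 0) :
    (leftMapF F (plainCat V W)).rank = Fintype.card P₁ * (leftMapF F W).rank := by
  rw [← rank_one (R := ℂ) (n := P₁), ← rank_kronecker,
    ← rank_submatrix ((1 : Matrix P₁ P₁ ℂ) ⊗ₖ leftMapF F W) (Equiv.refl _) (Equiv.prodAssoc _ _ _)]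
  apply rank_eq_of_gram_eq
  rw [conjTranspose_submatrix, submatrix_mul_equiv, conjTranspose_kronecker, ← mul_kronecker_mul,
    conjTranspose_one, Matrix.one_mul]
  ext x y
  rw [gram_leftMapF_plainCat h, submatrix_apply, kroneckerMap_apply, one_apply, ite_mul, one_mul,
    zero_mul]
  rfl

/-- `F` is injective on the vectors supported in `s`. -/
def InjectiveOnSupport [Fintype A] (s : A → Prop) (F : Matrix I A ℂ) : Prop :=
  ∀ y : A → ℂ, (∀ α, ¬ s α → y α = 0) → F *ᵥ y = 0 → y = 0

/-- Every output of `leftMap V` has auxiliary part supported in `s`, so applying `F` to it creates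
no new kernel. -/
theorem rank_leftMapF_of_injectiveOnSupport [Fintype P] [Fintype A] [Fintype I] {s : A → Prop}
    {F : Matrix I A ℂ} (hF : InjectiveOnSupport s F) {V : MPOTensor P A}
    (hV : ∀ n m α β, ¬ s α → V n m α β = 0) : (leftMapF F V).rank = (leftMap V).rank := by
  have key : ∀ z n, (fun i => (leftMapF F V *ᵥ z) (n, i)) =
      F *ᵥ fun α => (leftMap V *ᵥ z) (n, α) := by
    intro z n
    ext i
    simp only [mulVec, dotProduct, leftMapF, leftMap, of_apply, mul_apply, Finset.mul_sum,
      Finset.sum_mul]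
    rw [Finset.sum_comm]
    exact Finset.sum_congr rfl fun α _ => Finset.sum_congr rfl fun x _ => by ring
  apply rank_eq_of_mulVec_eq_zero_iff
  intro z
  constructor
  · intro hz
    ext x
    have := hF (fun α => (leftMap V *ᵥ z) (x.1, α)) ?_ ?_
    · exact congrFun this x.2
    · intro α hα
      simp only [mulVec, dotProduct, leftMap, of_apply, hV _ _ α _ hα, zero_mul,
        Finset.sum_const_zero]
    · rw [← key, hz]
      rfl
  · intro hz
    ext x
    have := congrFun (key z x.1) x.2
    rw [hz] at this
    exact this.trans (congrFun (mulVec_zero F) x.2)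

/-- Regrouping of tensor factors. -/
def regroup (P A B : Type*) : P × (A × B) ≃ (P × B) × A where
  toFun x := ((x.1, x.2.2), x.2.1)
  invFun x := (x.1.1, (x.2, x.1.2))
  left_inv _ := rfl
  right_inv _ := rfl

/-- The left map of a composition is the product of the left maps. -/
theorem leftMapF_plainCompose [Fintype P] [Fintype A] [DecidableEq A] [Fintype B] [DecidableEq B]
    (F : Matrix I A ℂ) (V : MPOTensor P A) (N : MPOTensor P B) :
    leftMapF (F ⊗ₖ (1 : Matrix B B ℂ)) (plainCompose V N) =
      (leftMapF F V ⊗ₖ (1 : Matrix B B ℂ)).submatrix (Equiv.prodAssoc P I B).symm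
          (Equiv.prodAssoc P A B).symm *
        (leftMap N ⊗ₖ (1 : Matrix A A ℂ)).submatrix (regroup P A B) (regroup P A B) := by
  ext ⟨n, i, b⟩ ⟨m, α, β⟩
  rw [mul_apply, Fintype.sum_prod_type]
  simp only [leftMapF, plainCompose, Matrix.mul_sum, ← mul_kronecker_mul, Matrix.one_mul, of_apply,
    Matrix.sum_apply, submatrix_apply, regroup, Equiv.coe_fn_mk, kroneckerMap_apply,
    Equiv.prodAssoc_symm_apply, leftMap, one_apply, mul_ite, mul_one, mul_zero, ite_mul, zero_mul,
    Fintype.sum_prod_type]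
  refine Finset.sum_congr rfl fun j _ => ?_
  simp

theorem rank_leftMap_plainCompose_of_isUnit [Fintype P] [DecidableEq P] [Fintype A] [Fintype B]
    [DecidableEq B] (V : MPOTensor P A) {N : MPOTensor P B} (hN : IsUnit (leftMap N).det) :
    (leftMap (plainCompose V N)).rank = Fintype.card B * (leftMap V).rank := by
  classical
  have h := leftMapF_plainCompose (1 : Matrix A A ℂ) V N
  rw [one_kronecker_one, leftMapF_one, leftMapF_one] at h
  rw [h, rank_mul_eq_left_of_isUnit_det, rank_submatrix, rank_kronecker, rank_one, mul_comm]
  rw [det_submatrix_equiv_self, det_kronecker, det_one, one_pow, mul_one]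
  exact hN.pow _

/-- The rank of the left map of a composition of concatenations. -/
theorem rank_leftMap_plainCompose_plainCat [Fintype P₁] [Fintype P₂] [Fintype A] [Fintype B]
    [Fintype I] {s : A → Prop} {F : Matrix I A ℂ} (hF : InjectiveOnSupport s F)
    {V : MPOTensor P₁ A} {W : MPOTensor P₂ A} (hV : ∀ n m α β, ¬ s α → V n m α β = 0)
    (hW : ∀ n m α β, ¬ s α → W n m α β = 0)
    (h : ∀ n m n' m', gramVec F ᵥ* (square V n m * square W n' m') =
      open scoped Classical in if n = m then gramVec F ᵥ* square W n' m' else 0)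
    {N : MPOTensor P₁ B} {M : MPOTensor P₂ B}
    (hN : (leftMap (plainCat N M)).rank = Fintype.card P₂ * (leftMap N).rank) :
    (leftMap (plainCompose (plainCat V W) (plainCat N M))).rank =
      (leftMap N).rank * (leftMap W).rank := by
  classical
  have hF' : InjectiveOnSupport (fun x : A × B => s x.1) (F ⊗ₖ (1 : Matrix B B ℂ)) := by
    intro y hy hFy
    ext ⟨α, b⟩
    refine congrFun (hF (fun α => y (α, b)) (fun α hα => hy (α, b) hα) ?_) α
    ext i
    have := congrFun hFy (i, b)
    simpa [mulVec, dotProduct, Fintype.sum_prod_type, one_apply] using this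
  have hs : ∀ n m x y, ¬ s (Prod.fst x) →
      plainCompose (plainCat V W) (plainCat N M) n m x y = 0 := by
    intro n m x y hx
    rw [plainCompose_apply]
    refine Finset.sum_eq_zero fun j _ => ?_
    simp [plainCat, mul_apply, hV _ _ _ _ hx]
  rw [← rank_leftMapF_of_injectiveOnSupport hF' hs, leftMapF_plainCompose]
  let e : (P₁ × B) × (P₂ × A) ≃ (P₁ × P₂) × (A × B) :=
    ⟨fun x => ((x.1.1, x.2.1), (x.2.2, x.1.2)), fun x => ((x.1.1, x.2.2), (x.1.2, x.2.1)),
      fun _ => rfl, fun _ => rfl⟩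
  let g : (P₁ × B) × (P₂ × A) ≃ (P₂ × B) × (P₁ × A) :=
    ⟨fun x => ((x.2.1, x.1.2), (x.1.1, x.2.2)), fun x => ((x.2.1, x.1.2), (x.1.1, x.2.2)),
      fun _ => rfl, fun _ => rfl⟩
  set X := (leftMapF F (plainCat V W) ⊗ₖ (1 : Matrix B B ℂ)).submatrix
    (Equiv.prodAssoc (P₁ × P₂) I B).symm (Equiv.prodAssoc (P₁ × P₂) A B).symm with hX
  set Z := (leftMap (plainCat N M) ⊗ₖ (1 : Matrix A A ℂ)).submatrix
    (regroup (P₁ × P₂) A B) (regroup (P₁ × P₂) A B) with hZ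
  have h1 : (X * Z).rank = (X.submatrix id e * Z.submatrix e e).rank := by
    rw [submatrix_mul_equiv]
    exact (rank_submatrix (X * Z) (Equiv.refl _) e).symm
  -- The first part of `V` disappears from the Gram matrix and leaves an identity on its physical
  -- index and on the auxiliary space of `N`.
  have hgram : (X.submatrix id e)ᴴ * X.submatrix id e =
      ((1 : Matrix (P₁ × B) (P₁ × B) ℂ) ⊗ₖ leftMapF F W)ᴴ *
        ((1 : Matrix (P₁ × B) (P₁ × B) ℂ) ⊗ₖ leftMapF F W) := by
    rw [conjTranspose_submatrix, ← submatrix_mul _ _ _ _ _ Function.bijective_id, hX,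
      conjTranspose_submatrix, submatrix_mul_equiv, conjTranspose_kronecker,
      conjTranspose_kronecker, ← mul_kronecker_mul, ← mul_kronecker_mul, conjTranspose_one,
      conjTranspose_one, Matrix.one_mul, Matrix.one_mul]
    ext ⟨⟨n, b⟩, ⟨n', α⟩⟩ ⟨⟨m, b'⟩, ⟨m', α'⟩⟩
    simp only [submatrix_apply, kroneckerMap_apply, e, Equiv.coe_fn_mk, Equiv.prodAssoc_symm_apply,
      one_apply, Prod.mk.injEq]
    rw [gram_leftMapF_plainCat (by convert h)]
    by_cases hn : n = m <;> by_cases hb : b = b' <;> simp [hn, hb]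
  -- The left map of a concatenation applies `M` first and then `N`; the two act on different
  -- physical factors and share the auxiliary space `B`.
  have hZ' : Z.submatrix e e = (leftMap N ⊗ₖ (1 : Matrix (P₂ × A) (P₂ × A) ℂ)) *
      (leftMap M ⊗ₖ (1 : Matrix (P₁ × A) (P₁ × A) ℂ)).submatrix g g := by
    ext ⟨⟨n, b⟩, ⟨n', α⟩⟩ ⟨⟨m, b'⟩, ⟨m', α'⟩⟩
    rw [mul_apply, Fintype.sum_prod_type, Fintype.sum_prod_type]
    simp only [hZ, submatrix_apply, regroup, e, g, Equiv.coe_fn_mk, kroneckerMap_apply, one_apply,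
      Fintype.sum_prod_type, Prod.mk.injEq, leftMap, of_apply, plainCat, mul_apply]
    simp [ite_and]
  -- By `hN` the product has the rank of its left factor alone, so `M` does not shrink the range and
  -- can be dropped. What remains is `leftMap N ⊗ₖ leftMapF F W`.
  have hrank : (leftMap N ⊗ₖ (1 : Matrix (P₂ × A) (P₂ × A) ℂ) *
      (leftMap M ⊗ₖ (1 : Matrix (P₁ × A) (P₁ × A) ℂ)).submatrix g g).rank =
      (leftMap N ⊗ₖ (1 : Matrix (P₂ × A) (P₂ × A) ℂ)).rank := by
    rw [← hZ', rank_submatrix, hZ, rank_submatrix, rank_kronecker, rank_kronecker, hN, rank_one,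
      rank_one, Fintype.card_prod]
    ring
  rw [h1, rank_mul_eq_of_gram_eq hgram, hZ', rank_mul_mul_eq_of_rank_eq hrank,
    ← mul_kronecker_mul, Matrix.one_mul, Matrix.mul_one, rank_kronecker,
    rank_leftMapF_of_injectiveOnSupport hF hW]

theorem rank_mul_diagonal_sgn {m n : Type*} [Fintype n] [DecidableEq n] (M : Matrix m n ℂ)
    (f : n → ZMod 2) : (M * diagonal fun x => sgn (f x)).rank = M.rank := by
  apply rank_mul_eq_left_of_isUnit_det
  rw [det_diagonal]
  exact (Finset.prod_ne_zero_iff.2 fun x _ => sgn_ne_zero _).isUnit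

theorem leftRank_eq [Fintype P] [Fintype A] (p : P → ZMod 2) (a : A → ZMod 2)
    (U : MPOTensor P A) : leftRank U = (leftMap (hat p a U)).rank := by
  classical
  rw [leftRank, ← rank_mul_diagonal_sgn (leftMap (hat p a U)) fun x => p x.1 * a x.2]
  congr 1
  ext x y
  simp only [mul_diagonal, leftMap, of_apply, hat_apply]
  linear_combination (-U x.1 y.1 x.2 y.2) * sgn_mul_self (p y.1 * a y.2)

theorem rightRank_eq [Fintype P] [Fintype A] {p : P → ZMod 2} {a : A → ZMod 2}
    {U : MPOTensor P A} (hU : IsEven p a U) :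
    rightRank p U = (leftMap (flip (hat p a U))).rank := by
  classical
  -- This column sign is what remains of `(-1)^{|n||m|}` relative to the `hat` sign once evenness
  -- eliminates the outgoing parity.
  rw [rightRank, ← rank_mul_diagonal_sgn (leftMap (flip (hat p a U)))
    fun x => p x.1 * (p x.1 + a x.2)]
  congr 1
  ext x y
  simp only [mul_diagonal, leftMap, flip, transpose_apply, of_apply, hat_apply, rightMap]
  by_cases h0 : U x.1 y.1 y.2 x.2 = 0
  · simp [h0]
  have h := hU _ _ _ _ h0
  have key : sgn (p x.1 * p y.1) = sgn (p y.1 * a x.2) * sgn (p y.1 * (p y.1 + a y.2)) := by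
    rw [← sgn_add]
    congr 1
    generalize p x.1 = b at *
    generalize p y.1 = c at *
    generalize a x.2 = d at *
    generalize a y.2 = e at *
    clear h0 hU
    decide +revert
  linear_combination (U x.1 y.1 y.2 x.2) * key

theorem rank_leftMap_congr {Q : Type*} [Fintype P] [Fintype Q] [Fintype A] (e : Q ≃ P)
    {V : MPOTensor P A} {W : MPOTensor Q A} (h : ∀ n m, V (e n) (e m) = W n m) :
    (leftMap V).rank = (leftMap W).rank := by
  rw [← rank_submatrix (leftMap V) (e.prodCongr (Equiv.refl A)) (e.prodCongr (Equiv.refl A))]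
  congr 1
  ext x y
  simp [leftMap, ← h]

theorem rank_leftMap_conj [Fintype P] [Fintype A] [DecidableEq A] {G : Matrix A A ℂ}
    (hG : G * G = 1) {V W : MPOTensor P A} (h : ∀ n m, W n m = G * V n m * G) :
    (leftMap W).rank = (leftMap V).rank := by
  classical
  have hdet : IsUnit ((1 : Matrix P P ℂ) ⊗ₖ G).det := by
    rw [det_kronecker, det_one, one_pow, one_mul]
    refine IsUnit.pow _ (IsUnit.of_mul_eq_one G.det ?_)
    rw [← det_mul, hG, det_one]
  have : leftMap W = ((1 : Matrix P P ℂ) ⊗ₖ G) * leftMap V * ((1 : Matrix P P ℂ) ⊗ₖ G) := by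
    ext ⟨n, α⟩ ⟨m, β⟩
    simp [leftMap, h, mul_apply, Fintype.sum_prod_type, one_apply]
  rw [this, rank_mul_eq_left_of_isUnit_det _ _ hdet, rank_mul_eq_right_of_isUnit_det _ _ hdet]

theorem rank_leftMap_plainBlock_add [Fintype P] [Fintype A] [DecidableEq A]
    (V : MPOTensor P A) (h k : ℕ) : (leftMap (plainBlock V (h + k))).rank =
      (leftMap (plainCat (plainBlock V h) (plainBlock V k))).rank :=
  rank_leftMap_congr (Fin.appendEquiv h k) fun n m => plainBlock_append V h k n.1 m.1 n.2 m.2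

/-- Transposition reverses words, so the last `h` sites become the first part of the concatenation.
-/
theorem rank_leftMap_flip_plainBlock_add [Fintype P] [Fintype A] [DecidableEq A]
    (V : MPOTensor P A) (h k : ℕ) : (leftMap (flip (plainBlock V (k + h)))).rank =
      (leftMap (plainCat (flip (plainBlock V h)) (flip (plainBlock V k)))).rank := by
  refine rank_leftMap_congr ((Equiv.prodComm _ _).trans (Fin.appendEquiv k h)) fun n m => ?_
  simp only [flip, plainCat, ← transpose_mul]
  exact congrArg transpose (plainBlock_append V k h n.2 m.2 n.1 m.1)

theorem rank_leftMap_plainCompose_plainBlock_add [Fintype P] [Fintype A] [DecidableEq A]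
    [Fintype B] [DecidableEq B] (V : MPOTensor P A) (N : MPOTensor P B) (h k : ℕ) :
    (leftMap (plainCompose (plainBlock V (h + k)) (plainBlock N (h + k)))).rank =
      (leftMap (plainCompose (plainCat (plainBlock V h) (plainBlock V k))
        (plainCat (plainBlock N h) (plainBlock N k)))).rank := by
  refine rank_leftMap_congr (Fin.appendEquiv h k) fun n m => ?_
  rw [plainCompose, plainCompose, ← (Fin.appendEquiv h k).sum_comp]
  refine Finset.sum_congr rfl fun j _ => ?_
  exact congrArg₂ (· ⊗ₖ ·) (plainBlock_append V h k n.1 j.1 n.2 j.2)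
    (plainBlock_append N h k j.1 m.1 j.2 m.2)

end Ranks

/-! ### Simple tensors -/

section Simple

variable {P A : Type*}

/-- The power `m` of the auxiliary parity operator. -/
def parityPow [DecidableEq A] (a : A → ZMod 2) (m : ZMod 2) : Matrix A A ℂ :=
  diagonal fun x => sgn (m * a x)

theorem parityPow_mul_self [Fintype A] [DecidableEq A] (a : A → ZMod 2) (m : ZMod 2) :
    parityPow a m * parityPow a m = 1 := by
  simp [parityPow]

theorem IsEven.parityPow_mul [Fintype A] [DecidableEq A] {p : P → ZMod 2} {a : A → ZMod 2}
    {U : MPOTensor P A} (hU : IsEven p a U) (s : ZMod 2) (n m : P) :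
    parityPow a s * U n m = sgn (s * (p n + p m)) • (U n m * parityPow a s) := by
  ext α β
  rw [parityPow, diagonal_mul, Matrix.smul_apply, mul_diagonal, smul_eq_mul]
  by_cases h0 : U n m α β = 0
  · simp [h0]
  have h := hU _ _ _ _ h0
  have key : sgn (s * a α) = sgn (s * (p n + p m)) * sgn (s * a β) := by
    rw [← sgn_add]
    congr 1
    generalize p n = b at *
    generalize p m = c at *
    generalize a α = d at *
    generalize a β = e at *
    clear h0 hU
    decide +revert
  linear_combination (U n m α β) * key

theorem IsEven.adj {p : P → ZMod 2} {a : A → ZMod 2} {U : MPOTensor P A} (h : IsEven p a U) :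
    IsEven p a (adj U) := by
  intro n m α β hne
  have := h m n α β fun h0 => hne (by simp [FMPU.adj, h0])
  linear_combination this

theorem IsEven.square [Fintype P] {p : P → ZMod 2} {a : A → ZMod 2} {U : MPOTensor P A}
    (hU : IsEven p a U) : IsEven p (addParity a a) (square U) := by
  intro k i x y hne
  rw [FMPU.square, plainCompose_apply] at hne
  obtain ⟨j, -, hj⟩ := Finset.exists_ne_zero_of_sum_ne_zero hne
  have h1 := hU.adj _ _ _ _ (left_ne_zero_of_mul hj)
  have h2 := hU _ _ _ _ (right_ne_zero_of_mul hj)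
  simp only [addParity]
  linear_combination h1 + h2 - CharTwo.add_self_eq_zero (p j)

/-- After passing to `hat` the only sign left is a parity on the right auxiliary pair, which the
transfer matrix of a simple tensor absorbs. -/
theorem stacked_eq [Fintype P] [Fintype A] [DecidableEq A] (p : P → ZMod 2) (a : A → ZMod 2)
    (U : MPOTensor P A) (k i : P) :
    stacked p a U k i = square (hat p a U) k i * parityPow (addParity a a) (p i) := by
  ext x y
  rw [parityPow, mul_diagonal, square, plainCompose_apply, stacked, of_apply, Finset.sum_mul]
  refine Finset.sum_congr rfl fun j _ => ?_
  simp only [adj, map_apply, hat_apply, star_mul', star_sgn, addParity]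
  have key : sgn (a y.1 * (p k + p i)) =
      sgn (p k * a y.1) * sgn (p i * a y.2) * sgn (p i * (a y.1 + a y.2)) := by
    simp only [← sgn_add]
    congr 1
    generalize p k = b
    generalize p i = c
    generalize a y.1 = d
    generalize a y.2 = e
    decide +revert
  linear_combination (star (U j k x.1 y.1) * U j i x.2 y.2) * key

theorem sum_stacked_self [Fintype P] (p : P → ZMod 2) (a : A → ZMod 2)
    (U : MPOTensor P A) : ∑ i, stacked p a U i i = transferMatrix U := by
  ext x y
  simp [stacked, transferMatrix, Matrix.sum_apply, CharTwo.add_self_eq_zero]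
  exact Finset.sum_comm

/-- All entries of the words of length `k`, as a matrix on the right auxiliary space. -/
def wordMatrix [Fintype A] [DecidableEq A] (U : MPOTensor P A) (k : ℕ) :
    Matrix (((Fin k → P) × (Fin k → P)) × A) A ℂ :=
  Matrix.of fun w α => plainBlock U k w.1.1 w.1.2 w.2 α

/-- All entries of the words of length `k`, as a matrix on the left auxiliary space. -/
def wordMatrixLeft [Fintype A] [DecidableEq A] (U : MPOTensor P A) (k : ℕ) :
    Matrix (((Fin k → P) × (Fin k → P)) × A) A ℂ :=
  Matrix.of fun w α => plainBlock U k w.1.1 w.1.2 α w.2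

/-- The vector `∑_α |α) ⊗ |α)`. -/
def bell (A : Type*) [DecidableEq A] : A × A → ℂ := fun x => if x.1 = x.2 then 1 else 0

theorem gramVec_wordMatrix [Fintype P] [Fintype A] [DecidableEq A] (U : MPOTensor P A) (k : ℕ) :
    gramVec (wordMatrix U k) = bell A ᵥ* transferMatrix (plainBlock U k) := by
  ext x
  rw [transferMatrix_eq_sum, gramVec, Fintype.sum_prod_type, Finset.sum_comm, vecMul, dotProduct,
    Fintype.sum_prod_type]
  refine Finset.sum_congr rfl fun α _ => ?_
  simp [bell, Matrix.sum_apply, wordMatrix]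

theorem gramVec_wordMatrixLeft [Fintype P] [Fintype A] [DecidableEq A] (U : MPOTensor P A)
    (k : ℕ) : gramVec (wordMatrixLeft U k) = transferMatrix (plainBlock U k) *ᵥ bell A := by
  ext x
  rw [transferMatrix_eq_sum, gramVec, Fintype.sum_prod_type, Finset.sum_comm, mulVec, dotProduct,
    Fintype.sum_prod_type]
  refine Finset.sum_congr rfl fun α _ => ?_
  simp [bell, Matrix.sum_apply, wordMatrixLeft]

theorem gramVec_even [Fintype P] [Fintype A] [DecidableEq A] {p : P → ZMod 2} {a : A → ZMod 2}
    {U : MPOTensor P A} (hU : IsEven p a U) (k : ℕ) (x : A × A)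
    (hx : gramVec (wordMatrix U k) x ≠ 0) : addParity a a x = 0 := by
  obtain ⟨i, -, hi⟩ := Finset.exists_ne_zero_of_sum_ne_zero hx
  have h1 := hU.plainBlock k _ _ _ _ (right_ne_zero_of_mul hi)
  have h2 := hU.plainBlock k i.1.1 i.1.2 i.2 x.1 fun h0 =>
    left_ne_zero_of_mul hi (by simp [wordMatrix, h0])
  simp only [addParity]
  linear_combination h1 + h2 - CharTwo.add_self_eq_zero (chainParity p k i.1.1) -
    CharTwo.add_self_eq_zero (chainParity p k i.1.2) - CharTwo.add_self_eq_zero (a i.2)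

theorem gramVec_left_even [Fintype P] [Fintype A] [DecidableEq A] {p : P → ZMod 2}
    {a : A → ZMod 2} {U : MPOTensor P A} (hU : IsEven p a U) (k : ℕ) (x : A × A)
    (hx : gramVec (wordMatrixLeft U k) x ≠ 0) : addParity a a x = 0 := by
  obtain ⟨i, -, hi⟩ := Finset.exists_ne_zero_of_sum_ne_zero hx
  have h1 := hU.plainBlock k _ _ _ _ (right_ne_zero_of_mul hi)
  have h2 := hU.plainBlock k i.1.1 i.1.2 x.1 i.2 fun h0 =>
    left_ne_zero_of_mul hi (by simp [wordMatrixLeft, h0])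
  simp only [addParity]
  linear_combination h1 + h2 - CharTwo.add_self_eq_zero (chainParity p k i.1.1) -
    CharTwo.add_self_eq_zero (chainParity p k i.1.2) - CharTwo.add_self_eq_zero (a i.2)

/-- The transfer matrix of `k` sites of a type I fMPU that is idempotent: it has rank one, is fixed
by the transfer matrix of one site and acts on the even sector only. -/
theorem idempotent_transferMatrix [Fintype P] [DecidableEq P] [Nonempty P] [Fintype A]
    [DecidableEq A] {p : P → ZMod 2} {a : A → ZMod 2} {U : MPOTensor P A}
    (hU : GeneratesTypeI p a U) {k : ℕ} (hk : 1 ≤ k)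
    (hE : normTransferMatrix U ^ k * normTransferMatrix U ^ k = normTransferMatrix U ^ k) :
    normTransferMatrix U * normTransferMatrix U ^ k = normTransferMatrix U ^ k ∧
    (∀ m, parityPow (addParity a a) m * normTransferMatrix U ^ k = normTransferMatrix U ^ k) ∧
    (∀ m, normTransferMatrix U ^ k * parityPow (addParity a a) m = normTransferMatrix U ^ k) := by
  have htr := trace_normTransferMatrix_pow hU k hk
  have htr' := trace_normTransferMatrix_pow hU (k + 1) (by omega)
  set E := normTransferMatrix U with hEdef
  set Q := E ^ k with hQ
  obtain ⟨u, v, huv⟩ := exists_eq_vecMulVec_of_idempotent hE htr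
  -- `E` commutes with its power `Q`. As `Q` has rank one, `Q * E * Q` is a multiple of `Q`, and the
  -- factor is `tr (E * Q) = tr E ^ (k + 1) = 1`.
  have h1 : E * Q = Q * E * Q := by
    have : Q * E = E * Q := by rw [hQ, ← pow_succ, ← pow_succ']
    rw [this, Matrix.mul_assoc, hE]
  have h2 : (E * Q).trace = v ⬝ᵥ (E *ᵥ u) := by
    rw [huv, mul_vecMulVec, trace_vecMulVec, dotProduct_comm]
  have h3 : Q * E * Q = (v ⬝ᵥ (E *ᵥ u)) • Q := by
    rw [Matrix.mul_assoc, huv, mul_vecMulVec, vecMulVec_mul_vecMulVec, vecMulVec_smul]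
  have hT : transferMatrix (plainBlock U k) = (Fintype.card P : ℂ) ^ k • Q := by
    have hd : (Fintype.card P : ℂ) ≠ 0 := Nat.cast_ne_zero.2 Fintype.card_ne_zero
    rw [transferMatrix_plainBlock, hQ, hEdef, normTransferMatrix, smul_pow, smul_smul, ← mul_pow,
      mul_inv_cancel₀ hd, one_pow, one_smul]
  -- This number is the sum of the squared moduli of all entries of words of length `k`. If it
  -- vanished, `Q` would vanish, contradicting trace one.
  have hne : bell A ⬝ᵥ (transferMatrix (plainBlock U k) *ᵥ bell A) ≠ 0 := by
    rw [dotProduct_mulVec, ← gramVec_wordMatrix, dotProduct, Fintype.sum_prod_type]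
    intro h0
    have h4 : ∑ α, ∑ i, star (wordMatrix U k i α) * wordMatrix U k i α = 0 := by
      rw [← h0]
      refine Finset.sum_congr rfl fun α _ => ?_
      simp [bell, gramVec]
    have h5 : ∀ i α, wordMatrix U k i α = 0 := by
      intro i α
      rw [Finset.sum_eq_zero_iff_of_nonneg fun α _ => Finset.sum_nonneg fun i _ =>
        star_mul_self_nonneg _] at h4
      have h6 := h4 α (Finset.mem_univ _)
      rw [Finset.sum_eq_zero_iff_of_nonneg fun i _ => star_mul_self_nonneg _] at h6
      have h7 := h6 i (Finset.mem_univ _)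
      simpa using h7
    have h8 : transferMatrix (plainBlock U k) = 0 := by
      ext x y
      simp only [transferMatrix, of_apply, Matrix.zero_apply]
      refine Finset.sum_eq_zero fun n _ => Finset.sum_eq_zero fun m _ => ?_
      have := h5 ((n, m), x.2) y.2
      rw [wordMatrix, of_apply] at this
      rw [this, mul_zero]
    rw [hT] at h8
    have h9 := congrArg Matrix.trace h8
    rw [trace_smul, htr, smul_eq_mul, mul_one, trace_zero] at h9
    exact pow_ne_zero _ (Nat.cast_ne_zero.2 Fintype.card_ne_zero) h9
  have hd : (Fintype.card P : ℂ) ^ k ≠ 0 :=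
    pow_ne_zero _ (Nat.cast_ne_zero.2 Fintype.card_ne_zero)
  have hne' : (bell A ⬝ᵥ u) ≠ 0 ∧ (v ⬝ᵥ bell A) ≠ 0 := by
    rw [hT, huv, smul_mulVec, vecMulVec_mulVec, dotProduct_smul, dotProduct_smul] at hne
    constructor
    · intro h0
      simp [h0] at hne
    · intro h0
      simp [h0] at hne
  -- Since `bell A ⬝ᵥ u ≠ 0`, the vector `v` is proportional to the Gram vector of the words, which
  -- is supported on even pairs.
  have hv : ∀ x, v x ≠ 0 → addParity a a x = 0 := by
    intro x hx
    refine gramVec_even hU.1 k x ?_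
    rw [gramVec_wordMatrix, hT, huv, vecMul_smul, vecMul_vecMulVec]
    exact mul_ne_zero hd (mul_ne_zero hne'.1 hx)
  have hu : ∀ x, u x ≠ 0 → addParity a a x = 0 := by
    intro x hx
    refine gramVec_left_even hU.1 k x ?_
    rw [gramVec_wordMatrixLeft, hT, huv, smul_mulVec, vecMulVec_mulVec]
    exact mul_ne_zero hd (mul_ne_zero hx hne'.2)
  refine ⟨?_, fun m => ?_, fun m => ?_⟩
  · rw [h1, h3, ← h2, hQ, ← pow_succ', htr', one_smul]
  · rw [huv]
    ext x y
    rw [parityPow, diagonal_mul, vecMulVec_apply]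
    by_cases h0 : u x = 0
    · simp [h0]
    · rw [hu x h0, mul_zero, sgn_zero, one_mul]
  · rw [huv]
    ext x y
    rw [parityPow, mul_diagonal, vecMulVec_apply]
    by_cases h0 : v y = 0
    · simp [h0]
    · rw [hv y h0, mul_zero, sgn_zero, mul_one]

/-- What the analysis of a simple tensor of `k` sites uses about its transfer matrix `Q` and the
matrices `S` of one site of `U†U`. -/
structure IsSimpleData [Fintype P] [DecidableEq P] [Fintype A] [DecidableEq A] (p : P → ZMod 2)
    (a : A → ZMod 2) (k : ℕ) (S : MPOTensor P A) (Q : Matrix A A ℂ) : Prop where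
  even : IsEven p a S
  parityPow_mul : ∀ m, parityPow a m * Q = Q
  mul_parityPow : ∀ m, Q * parityPow a m = Q
  sum_mul : (∑ i, S i i) * Q = (Fintype.card P : ℂ) • Q
  mul_mul : ∀ n m, Q * plainBlock S k n m * Q = if n = m then Q else 0
  mul_parityPow_mul : ∀ n m n' m', plainBlock S k n m * parityPow a (chainParity p k m) *
    plainBlock S k n' m' = plainBlock S k n m * Q * plainBlock S k n' m'

/-! ### Collapse of words of `U†U` next to the projection `Q` -/

namespace IsSimpleData

variable [Fintype P] [DecidableEq P] [Fintype A] [DecidableEq A] {p : P → ZMod 2}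
    {a : A → ZMod 2} {k : ℕ} {S : MPOTensor P A} {Q : Matrix A A ℂ}

/-- Simplicity replaces a parity operator between two words by `Q`. That parity operator is split
off from the `Q` on the left and moved through the even word, at the price of the displayed sign. -/
theorem append_mul (hS : IsSimpleData p a k S Q) {r : ℕ} (n m : Fin (r + k) → P)
    (n' m' : Fin k → P) :
    ∃ s : ZMod 2, Q * plainBlock S (r + k) n m * plainBlock S k n' m' =
      sgn (s * (chainParity p (r + k) n + chainParity p (r + k) m)) •
        (Q * plainBlock S (r + k) n m * Q * plainBlock S k n' m') := by
  have heven := hS.even.plainBlock (r + k)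
  obtain ⟨⟨n₁, n₂⟩, rfl⟩ := (Fin.appendEquiv r k).surjective n
  obtain ⟨⟨m₁, m₂⟩, rfl⟩ := (Fin.appendEquiv r k).surjective m
  have happ := plainBlock_append S r k n₁ m₁ n₂ m₂
  set μ := chainParity p k m₂
  set X := plainBlock S (r + k) ((Fin.appendEquiv r k) (n₁, n₂)) ((Fin.appendEquiv r k) (m₁, m₂))
  have h1 : Q * X = sgn (μ * (chainParity p (r + k) ((Fin.appendEquiv r k) (n₁, n₂)) +
      chainParity p (r + k) ((Fin.appendEquiv r k) (m₁, m₂)))) • (Q * X * parityPow a μ) := by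
    conv_lhs => rw [← hS.mul_parityPow μ, Matrix.mul_assoc, heven.parityPow_mul]
    rw [Matrix.mul_smul, Matrix.mul_assoc]
  refine ⟨μ, ?_⟩
  conv_lhs => rw [h1]
  rw [Matrix.smul_mul]
  congr 1
  have hX : X = plainBlock S r n₁ m₁ * plainBlock S k n₂ m₂ := happ
  have h2 := hS.mul_parityPow_mul n₂ m₂ n' m'
  rw [hX]
  calc Q * (plainBlock S r n₁ m₁ * plainBlock S k n₂ m₂) * parityPow a μ * plainBlock S k n' m'
      = Q * plainBlock S r n₁ m₁ *
        (plainBlock S k n₂ m₂ * parityPow a μ * plainBlock S k n' m') := by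
          simp only [Matrix.mul_assoc]
    _ = _ := by
          rw [h2]
          simp only [Matrix.mul_assoc]

theorem mul_append (hS : IsSimpleData p a k S Q) {r : ℕ} (n m : Fin k → P)
    (n' m' : Fin (k + r) → P) :
    ∃ s : ZMod 2, plainBlock S k n m * (plainBlock S (k + r) n' m' * Q) =
      sgn (s * (chainParity p (k + r) n' + chainParity p (k + r) m')) •
        (plainBlock S k n m * (Q * plainBlock S (k + r) n' m' * Q)) := by
  have heven := hS.even.plainBlock (k + r)
  obtain ⟨⟨n₁, n₂⟩, rfl⟩ := (Fin.appendEquiv k r).surjective n'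
  obtain ⟨⟨m₁, m₂⟩, rfl⟩ := (Fin.appendEquiv k r).surjective m'
  have happ := plainBlock_append S k r n₁ m₁ n₂ m₂
  set μ := chainParity p k m
  set X := plainBlock S (k + r) ((Fin.appendEquiv k r) (n₁, n₂)) ((Fin.appendEquiv k r) (m₁, m₂))
  have h1 : X * Q = sgn (μ * (chainParity p (k + r) ((Fin.appendEquiv k r) (n₁, n₂)) +
      chainParity p (k + r) ((Fin.appendEquiv k r) (m₁, m₂)))) • (parityPow a μ * (X * Q)) := by
    rw [← Matrix.mul_assoc, heven.parityPow_mul, Matrix.smul_mul, smul_smul, sgn_mul_self,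
      one_smul, Matrix.mul_assoc, hS.parityPow_mul]
  refine ⟨μ, ?_⟩
  conv_lhs => rw [h1]
  rw [Matrix.mul_smul]
  congr 1
  have hX : X = plainBlock S k n₁ m₁ * plainBlock S r n₂ m₂ := happ
  have h2 := hS.mul_parityPow_mul n m n₁ m₁
  rw [hX]
  calc plainBlock S k n m * (parityPow a μ * (plainBlock S k n₁ m₁ * plainBlock S r n₂ m₂ * Q))
      = plainBlock S k n m * parityPow a μ * plainBlock S k n₁ m₁ *
        (plainBlock S r n₂ m₂ * Q) := by
          simp only [Matrix.mul_assoc]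
    _ = _ := by
          rw [h2]
          simp only [Matrix.mul_assoc]

/-- `Q S Q = δ Q` for the matrices of `h` sites. -/
def Collapses (S : MPOTensor P A) (Q : Matrix A A ℂ) (h : ℕ) : Prop :=
  ∀ n m : Fin h → P, Q * plainBlock S h n m * Q = if n = m then Q else 0

/-- The sign of `append_mul` is harmless: it is trivial for `n = m`, and for `n ≠ m` the collapse
already gives zero. -/
theorem mul_block_mul (hS : IsSimpleData p a k S Q) {r : ℕ} (hC : Collapses S Q (r + k))
    (n m : Fin (r + k) → P) (n' m' : Fin k → P) :
    Q * (plainBlock S (r + k) n m * plainBlock S k n' m') =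
      if n = m then Q * plainBlock S k n' m' else 0 := by
  obtain ⟨s, hs⟩ := hS.append_mul n m n' m'
  rw [← Matrix.mul_assoc, hs, hC]
  split_ifs with h
  · rw [h, CharTwo.add_self_eq_zero, mul_zero, sgn_zero, one_smul]
  · rw [Matrix.zero_mul, smul_zero]

theorem block_mul_mul (hS : IsSimpleData p a k S Q) {r : ℕ} (hC : Collapses S Q (k + r))
    (n m : Fin k → P) (n' m' : Fin (k + r) → P) :
    plainBlock S k n m * plainBlock S (k + r) n' m' * Q =
      if n' = m' then plainBlock S k n m * Q else 0 := by
  obtain ⟨s, hs⟩ := hS.mul_append n m n' m'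
  rw [Matrix.mul_assoc, hs, hC]
  split_ifs with h
  · rw [h, CharTwo.add_self_eq_zero, mul_zero, sgn_zero, one_smul]
  · rw [Matrix.mul_zero, smul_zero]

theorem append_eq_append_iff {X : Type*} {h l : ℕ} (n m : Fin h → X) (n' m' : Fin l → X) :
    Fin.append n n' = Fin.append m m' ↔ n = m ∧ n' = m' := by
  rw [← Prod.mk.injEq]
  exact (Fin.appendEquiv h l).injective.eq_iff (a := (n, n')) (b := (m, m'))

/-- Tracing out the last site works because `Q` is fixed by the normalized transfer matrix of one
site. -/
theorem collapses_of_succ [Nonempty P] (hS : IsSimpleData p a k S Q) {h : ℕ}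
    (hC : Collapses S Q (h + 1)) : Collapses S Q h := by
  intro n m
  have hd : (Fintype.card P : ℂ) ≠ 0 := Nat.cast_ne_zero.2 Fintype.card_ne_zero
  refine smul_right_injective _ hd ?_
  have h1 : ∀ i : P, plainBlock S h n m * S i i =
      plainBlock S (h + 1) (Fin.append n fun _ => i) (Fin.append m fun _ => i) := by
    intro i
    rw [plainBlock_append]
    simp [plainBlock]
  calc (Fintype.card P : ℂ) • (Q * plainBlock S h n m * Q)
      = ∑ i, Q * (plainBlock S h n m * S i i) * Q := by
        rw [← Matrix.mul_smul, ← hS.sum_mul, ← Finset.sum_mul, ← Finset.mul_sum, ← Finset.mul_sum]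
        simp only [Matrix.mul_assoc]
    _ = ∑ i : P, if n = m then Q else 0 := by
        refine Finset.sum_congr rfl fun i _ => ?_
        rw [h1, hC]
        simp only [append_eq_append_iff, and_true]
    _ = _ := by
        rw [Finset.sum_const, Finset.card_univ]
        exact (Nat.cast_smul_eq_nsmul ℂ _ _).symm

theorem collapses_of_le [Nonempty P] (hS : IsSimpleData p a k S Q) {h l : ℕ} (hl : h ≤ l)
    (hC : Collapses S Q l) : Collapses S Q h := by
  induction hl with
  | refl => exact hC
  | step _ ih => exact ih (hS.collapses_of_succ hC)

/-- Each further group of `k` sites is separated from the preceding ones by an inserted `Q` and then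
collapsed by simplicity itself. -/
theorem collapses_mul (hS : IsSimpleData p a k S Q) (c : ℕ) : Collapses S Q (c * k + k) := by
  induction c with
  | zero =>
    rw [zero_mul, zero_add]
    exact hS.mul_mul
  | succ c ih =>
    rw [add_mul, one_mul]
    intro n m
    obtain ⟨⟨n₁, n₂⟩, rfl⟩ := (Fin.appendEquiv (c * k + k) k).surjective n
    obtain ⟨⟨m₁, m₂⟩, rfl⟩ := (Fin.appendEquiv (c * k + k) k).surjective m
    change Q * plainBlock S _ (Fin.append n₁ n₂) (Fin.append m₁ m₂) * Q =
      if Fin.append n₁ n₂ = Fin.append m₁ m₂ then Q else 0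
    rw [plainBlock_append, hS.mul_block_mul ih, ite_mul, hS.mul_mul, Matrix.zero_mul]
    simp only [append_eq_append_iff, ite_and]

theorem collapses [Nonempty P] (hS : IsSimpleData p a k S Q) (hk : 1 ≤ k) (h : ℕ) :
    Collapses S Q h :=
  hS.collapses_of_le (by nlinarith) (hS.collapses_mul h)

end IsSimpleData

theorem isSimpleData [Fintype P] [DecidableEq P] [Nonempty P] [Fintype A]
    [DecidableEq A] {p : P → ZMod 2} {a : A → ZMod 2} {U : MPOTensor P A}
    (hU : GeneratesTypeI p a U) {k : ℕ} (hk : 1 ≤ k)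
    (hS : IsSimple (chainParity p k) a (block p U k)) :
    IsSimpleData p (addParity a a) k (square (hat p a U)) (normTransferMatrix U ^ k) := by
  obtain ⟨h1, h2, h3⟩ := hS
  simp only [normTransferMatrix_block, stacked_eq, hat_block hU.1, ← plainBlock_square] at h1 h2 h3
  obtain ⟨hE, hl, hr⟩ := idempotent_transferMatrix hU hk h3
  refine ⟨hU.1.hat.square, hl, hr, ?_, fun n m => ?_, fun n m n' m' => ?_⟩
  · have hd : (Fintype.card P : ℂ) ≠ 0 := Nat.cast_ne_zero.2 Fintype.card_ne_zero
    have h4 : (∑ i, stacked p a U i i) * normTransferMatrix U ^ k =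
        (Fintype.card P : ℂ) • normTransferMatrix U ^ k := by
      rw [sum_stacked_self]
      conv_rhs => rw [← hE]
      rw [← Matrix.smul_mul]
      congr 1
      rw [normTransferMatrix, smul_smul, mul_inv_cancel₀ hd, one_smul]
    rw [← h4, Finset.sum_mul, Finset.sum_mul]
    refine Finset.sum_congr rfl fun i _ => ?_
    rw [stacked_eq, Matrix.mul_assoc, hl]
  · rw [← h1, Matrix.mul_assoc, Matrix.mul_assoc, Matrix.mul_assoc, hl]
  -- Right multiplication by the parity of the second word cancels its sign; the parity left over
  -- from the first word stays in the middle.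
  · have h4 := congrArg (· * parityPow (addParity a a) (chainParity p k m')) (h2 n m n' m')
    simp only [Matrix.mul_assoc, parityPow_mul_self, Matrix.mul_one] at h4
    rw [Matrix.mul_assoc, h4, ← Matrix.mul_assoc (parityPow _ _), hl, Matrix.mul_assoc]

end Simple

/-! ### Graded canonical form -/

section Canonical

variable {P A : Type*}

theorem exists_plainBlock_mul_eq [Fintype A] [DecidableEq A] (U : MPOTensor P A) (k : ℕ)
    (n m : Fin k → P) (n' m' : P) : ∃ (i j : P) (i' j' : Fin k → P),
      plainBlock U k n m * U n' m' = U i j * plainBlock U k i' j' := by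
  have h := plainBlock_append U k 1 n m (fun _ => n') (fun _ => m')
  rw [plainBlock_succ] at h
  refine ⟨_, _, _, _, Eq.trans ?_ h.symm⟩
  simp [plainBlock]

theorem exists_mul_plainBlock_eq [Fintype A] [DecidableEq A] (U : MPOTensor P A) (k : ℕ)
    (n m : Fin k → P) (n' m' : P) : ∃ (i j : P) (i' j' : Fin k → P),
      U n' m' * plainBlock U k n m = plainBlock U k i' j' * U i j := by
  have h := plainBlock_succ U k (Fin.cons n' n : Fin (k + 1) → P) (Fin.cons m' m)
  simp only [Fin.cons_zero, Fin.cons_succ] at h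
  obtain ⟨⟨n₁, n₂⟩, hn⟩ := (Fin.appendEquiv k 1).surjective (Fin.cons n' n : Fin (k + 1) → P)
  obtain ⟨⟨m₁, m₂⟩, hm⟩ := (Fin.appendEquiv k 1).surjective (Fin.cons m' m : Fin (k + 1) → P)
  change Fin.append n₁ n₂ = _ at hn
  change Fin.append m₁ m₂ = _ at hm
  rw [← hn, ← hm, plainBlock_append] at h
  refine ⟨n₂ 0, m₂ 0, n₁, m₁, h.symm.trans ?_⟩
  simp [plainBlock]

theorem parityOp_eq [DecidableEq A] (a : A → ZMod 2) : parityOp a = parityPow a 1 := by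
  simp [parityOp, parityPow]

theorem IsEven.mulVec_parityOp [Fintype A] [DecidableEq A] {p : P → ZMod 2} {a : A → ZMod 2}
    {U : MPOTensor P A} (hU : IsEven p a U) (n m : P) (y : A → ℂ) :
    U n m *ᵥ (parityOp a *ᵥ y) = sgn (p n + p m) • (parityOp a *ᵥ (U n m *ᵥ y)) := by
  rw [mulVec_mulVec, mulVec_mulVec, parityOp_eq, hU.parityPow_mul, smul_mulVec, smul_smul, one_mul,
    sgn_mul_self, one_smul]

theorem IsEven.vecMul_parityOp [Fintype A] [DecidableEq A] {p : P → ZMod 2} {a : A → ZMod 2}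
    {U : MPOTensor P A} (hU : IsEven p a U) (n m : P) (y : A → ℂ) :
    (y ᵥ* parityOp a) ᵥ* U n m = sgn (p n + p m) • ((y ᵥ* U n m) ᵥ* parityOp a) := by
  rw [vecMul_vecMul, vecMul_vecMul, parityOp_eq, hU.parityPow_mul, vecMul_smul, one_mul]

/-- An eigenvector of eigenvalue `1` is fixed by every power of the transfer matrix, so that power
cannot vanish. -/
theorem exists_plainBlock_ne_zero [Fintype P] [Fintype A] [DecidableEq A] {T : MPOTensor P A}
    (hT : (transferMatrix T).charpoly.rootMultiplicity 1 ≠ 0) (k : ℕ) :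
    ∃ n m, plainBlock T k n m ≠ 0 := by
  have hroot : (transferMatrix T).charpoly.IsRoot 1 :=
    (Polynomial.rootMultiplicity_pos'.1 (Nat.pos_of_ne_zero hT)).2
  have hdet : (1 - transferMatrix T).det = 0 := by
    rw [Polynomial.IsRoot, eval_charpoly] at hroot
    simpa using hroot
  obtain ⟨v, hv, hTv⟩ := exists_mulVec_eq_zero_iff.2 hdet
  rw [sub_mulVec, one_mulVec, sub_eq_zero] at hTv
  have hpow : ∀ j : ℕ, transferMatrix T ^ j *ᵥ v = v := by
    intro j
    induction j with
    | zero => simp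
    | succ j ih => rw [pow_succ, ← mulVec_mulVec, ← hTv, ih]
  by_contra! hzero
  refine hv ?_
  rw [← hpow k, ← transferMatrix_plainBlock]
  have : transferMatrix (plainBlock T k) = 0 := by
    ext x y
    simp [transferMatrix, hzero]
  rw [this, zero_mulVec]

/-- The common kernel of all words of length `k` is graded, and it is invariant because a word times
a letter is a letter times another word. It is not everything, since some word is nonzero, so
irreducibility makes it zero. -/
theorem eq_zero_of_plainBlock_mulVec [Fintype P] [Fintype A] [DecidableEq A] {p : P → ZMod 2}
    {a : A → ZMod 2} {T : MPOTensor P A} (hT : IsGradedNormal p a T) (k : ℕ) (y : A → ℂ)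
    (hy : ∀ n m, plainBlock T k n m *ᵥ y = 0) : y = 0 := by
  obtain ⟨heven, hirr, -, hmult⟩ := hT
  let W : Submodule ℂ (A → ℂ) :=
    { carrier := {x | ∀ n m, plainBlock T k n m *ᵥ x = 0}
      add_mem' := fun {x z} hx hz n m => by rw [mulVec_add, hx, hz, add_zero]
      zero_mem' := fun n m => mulVec_zero _
      smul_mem' := fun c x hx n m => by rw [mulVec_smul, hx, smul_zero] }
  have hpar : ∀ v ∈ W, parityOp a *ᵥ v ∈ W := by
    intro v hv n m
    rw [(heven.plainBlock k).mulVec_parityOp, hv n m, mulVec_zero, smul_zero]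
  have hinv : ∀ n m, ∀ v ∈ W, T n m *ᵥ v ∈ W := by
    intro n' m' v hv n m
    obtain ⟨i, j, i', j', h⟩ := exists_plainBlock_mul_eq T k n m n' m'
    rw [mulVec_mulVec, h, ← mulVec_mulVec, hv i' j', mulVec_zero]
  rcases hirr W hpar hinv with h | h
  · have : y ∈ W := hy
    rwa [h, Submodule.mem_bot] at this
  · obtain ⟨n, m, hne⟩ := exists_plainBlock_ne_zero (T := T) (by omega) k
    refine absurd ?_ hne
    refine Matrix.ext_of_mulVec_single fun i => ?_
    have : Pi.single i 1 ∈ W := h ▸ Submodule.mem_top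
    rw [this n m, zero_mulVec]

/-- Irreducibility concerns column vectors, so it is applied to the annihilator of the common left
kernel. That annihilator contains the ranges of all words and is therefore nonzero. -/
theorem eq_zero_of_vecMul_plainBlock [Fintype P] [Fintype A] [DecidableEq A] {p : P → ZMod 2}
    {a : A → ZMod 2} {T : MPOTensor P A} (hT : IsGradedNormal p a T) (k : ℕ) (y : A → ℂ)
    (hy : ∀ n m, y ᵥ* plainBlock T k n m = 0) : y = 0 := by
  obtain ⟨heven, hirr, -, hmult⟩ := hT
  let W : Submodule ℂ (A → ℂ) :=
    { carrier := {x | ∀ z, (∀ n m, z ᵥ* plainBlock T k n m = 0) → z ⬝ᵥ x = 0}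
      add_mem' := fun {x x'} hx hx' z hz => by rw [dotProduct_add, hx z hz, hx' z hz, add_zero]
      zero_mem' := fun z _ => dotProduct_zero z
      smul_mem' := fun c x hx z hz => by rw [dotProduct_smul, hx z hz, smul_zero] }
  have hpar : ∀ v ∈ W, parityOp a *ᵥ v ∈ W := by
    intro v hv z hz
    rw [dotProduct_mulVec]
    refine hv _ fun n m => ?_
    rw [(heven.plainBlock k).vecMul_parityOp, hz n m, zero_vecMul, smul_zero]
  have hinv : ∀ n m, ∀ v ∈ W, T n m *ᵥ v ∈ W := by
    intro n' m' v hv z hz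
    rw [dotProduct_mulVec]
    refine hv _ fun n m => ?_
    obtain ⟨i, j, i', j', h⟩ := exists_mul_plainBlock_eq T k n m n' m'
    rw [vecMul_vecMul, h, ← vecMul_vecMul, hz i' j', zero_vecMul]
  rcases hirr W hpar hinv with h | h
  · obtain ⟨n, m, hne⟩ := exists_plainBlock_ne_zero (T := T) (by omega) k
    refine absurd ?_ hne
    refine Matrix.ext_of_mulVec_single fun i => ?_
    have : plainBlock T k n m *ᵥ Pi.single i 1 ∈ W := by
      intro z hz
      rw [dotProduct_mulVec, hz, zero_dotProduct]
    rw [h, Submodule.mem_bot] at this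
    rw [this, zero_mulVec]
  · ext i
    have : Pi.single i 1 ∈ W := h ▸ Submodule.mem_top
    simpa using this y hy

theorem sum_eq_sum_subtype {X M : Type*} [Fintype X] [AddCommMonoid M] (q : X → Prop)
    [DecidablePred q] (f : X → M) (h : ∀ x, ¬ q x → f x = 0) :
    ∑ x, f x = ∑ x : {x // q x}, f x := by
  rw [← Fintype.sum_subtype_add_sum_subtype q f, Finset.sum_eq_zero (s := Finset.univ)
    (f := fun x : {x // ¬ q x} => f x) fun x _ => h x x.2, add_zero]

theorem plainBlock_eq_zero_of_ne [Fintype A] [DecidableEq A] {r : ℕ} {b : A → Fin r}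
    {U : MPOTensor P A} (h : ∀ n m α β, b α ≠ b β → U n m α β = 0) (k : ℕ) (n m : Fin k → P)
    (α β : A) (hαβ : b α ≠ b β) : plainBlock U k n m α β = 0 := by
  induction k generalizing α with
  | zero =>
    have : α ≠ β := fun h => hαβ (h ▸ rfl)
    simp [plainBlock, one_apply_ne this]
  | succ k ih =>
    rw [plainBlock_succ, mul_apply]
    refine Finset.sum_eq_zero fun x _ => ?_
    by_cases hx : b α = b x
    · rw [ih _ _ x (hx ▸ hαβ), mul_zero]
    · rw [h _ _ _ _ hx, zero_mul]

theorem plainBlock_eq_of_block [Fintype A] [DecidableEq A] {r : ℕ} {b : A → Fin r}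
    {U : MPOTensor P A} (h : ∀ n m α β, b α ≠ b β → U n m α β = 0) {i : Fin r} {μ : ℂ}
    {B : MPOTensor P {α : A // b α = i}} (hB : ∀ n m (α β : {α : A // b α = i}),
      U n m α β = μ * B n m α β) (k : ℕ) (n m : Fin k → P) (α β : {α : A // b α = i}) :
    plainBlock U k n m α β = μ ^ k * plainBlock B k n m α β := by
  induction k generalizing α with
  | zero => simp [plainBlock, one_apply, Subtype.ext_iff]
  | succ k ih =>
    rw [plainBlock_succ, plainBlock_succ, mul_apply, mul_apply,
      sum_eq_sum_subtype fun x => b x = i, Finset.mul_sum]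
    · refine Finset.sum_congr rfl fun x _ => ?_
      rw [ih, hB]
      ring
    · intro x hx
      rw [h _ _ _ _ fun h => hx (h ▸ α.2), zero_mul]

/-- The words of a tensor in graded canonical form have no common kernel on either side, apart
from the blocks with coefficient zero. -/
theorem IsGCF.exists_support [Fintype P] [Fintype A] [DecidableEq A] {p : P → ZMod 2}
    {a : A → ZMod 2} {U : MPOTensor P A} (hU : IsGCF p a U) : ∃ s : A → Prop,
      (∀ n m α β, ¬ s α → U n m α β = 0) ∧ (∀ n m α β, ¬ s β → U n m α β = 0) ∧
      (∀ k, InjectiveOnSupport s (wordMatrix U k)) ∧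
      ∀ k, InjectiveOnSupport s (wordMatrixLeft U k) := by
  obtain ⟨-, r, b, μ, B, hoff, hblock, hnormal⟩ := hU
  have hzero : ∀ n m α β, μ (b α) = 0 → U n m α β = 0 := by
    intro n m α β h
    by_cases hb : b α = b β
    · rw [hblock (b α) n m ⟨α, rfl⟩ ⟨β, hb.symm⟩, h, zero_mul]
    · exact hoff _ _ _ _ hb
  -- Blocks with `μ = 0` are invisible to the tensor. On the others words differ from those of the
  -- normal tensor by the nonzero factor `μ ^ k`.
  refine ⟨fun α => μ (b α) ≠ 0, fun n m α β h => hzero n m α β (not_not.1 h), ?_, ?_, ?_⟩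
  · intro n m α β h
    by_cases hb : b α = b β
    · exact hzero _ _ _ _ (hb ▸ not_not.1 h)
    · exact hoff _ _ _ _ hb
  · intro k y hy hF
    ext α
    by_cases hα : μ (b α) = 0
    · exact hy α (not_not.2 hα)
    have := eq_zero_of_plainBlock_mulVec (hnormal (b α)) k
      (fun x : {x : A // b x = b α} => y x) fun n m => ?_
    · exact congrFun this ⟨α, rfl⟩
    ext x
    refine (mul_eq_zero.1 ?_).resolve_left (pow_ne_zero k hα)
    have h1 := congrFun hF ((n, m), (x : A))
    rw [mulVec, dotProduct, sum_eq_sum_subtype fun z => b z = b α] at h1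
    · simp only [wordMatrix, of_apply,
        plainBlock_eq_of_block hoff (hblock (b α)) k n m] at h1
      rw [mulVec, dotProduct, Finset.mul_sum]
      refine Eq.trans (Finset.sum_congr rfl fun z _ => ?_) h1
      ring
    · intro z hz
      rw [wordMatrix, of_apply, plainBlock_eq_zero_of_ne hoff k n m, zero_mul]
      exact fun h => hz (h ▸ x.2)
  · intro k y hy hF
    ext α
    by_cases hα : μ (b α) = 0
    · exact hy α (not_not.2 hα)
    have := eq_zero_of_vecMul_plainBlock (hnormal (b α)) k
      (fun x : {x : A // b x = b α} => y x) fun n m => ?_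
    · exact congrFun this ⟨α, rfl⟩
    ext x
    refine (mul_eq_zero.1 ?_).resolve_left (pow_ne_zero k hα)
    have h1 := congrFun hF ((n, m), (x : A))
    rw [mulVec, dotProduct, sum_eq_sum_subtype fun z => b z = b α] at h1
    · simp only [wordMatrixLeft, of_apply,
        plainBlock_eq_of_block hoff (hblock (b α)) k n m] at h1
      rw [vecMul, dotProduct, Finset.mul_sum]
      refine Eq.trans (Finset.sum_congr rfl fun z _ => ?_) h1
      ring
    · intro z hz
      rw [wordMatrixLeft, of_apply, plainBlock_eq_zero_of_ne hoff k n m, zero_mul]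
      exact fun h => hz (h.trans x.2)

end Canonical

/-! ### The Majorana shift -/

section Majorana

theorem modeParity_zero : modeParity 0 = 0 := rfl

theorem modeParity_one : modeParity 1 = 1 := rfl

theorem majorana_apply (n m α β : Fin 2) : majorana n m α β =
    Complex.I ^ (m : ℕ) / (Real.sqrt 2 : ℂ) *
      if modeParity n + modeParity m + modeParity α + modeParity β = 0 then 1 else 0 := by
  rw [majorana, Matrix.smul_apply, smul_eq_mul]
  congr 1
  fin_cases n <;> fin_cases m <;> fin_cases α <;> fin_cases β <;>
    simp [modeParity, pow_succ, CharTwo.add_self_eq_zero]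

/-- The tensor of the Majorana shift without signs, on a site whose ancilla has parity `c`. -/
def plainMajorana (c : ZMod 2) : MPOTensor (Fin 2) (Fin 2) :=
  hat (fun n => modeParity n + c) modeParity majorana

theorem square_plainMajorana_apply (c : ZMod 2) (k i : Fin 2) (x y : Fin 2 × Fin 2) :
    square (plainMajorana c) k i x y =
      (1 / 2) * ((-Complex.I) ^ (k : ℕ) * Complex.I ^ (i : ℕ)) *
        sgn ((modeParity k + c) * modeParity y.1 + (modeParity i + c) * modeParity y.2) *
        if modeParity k + modeParity x.1 + modeParity y.1 =
          modeParity i + modeParity x.2 + modeParity y.2 then 1 else 0 := by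
  have h2 : ((Real.sqrt 2 : ℝ) : ℂ) * (Real.sqrt 2 : ℝ) = 2 := by
    rw [← Complex.ofReal_mul, Real.mul_self_sqrt zero_le_two]
    norm_num
  have h0 : ((Real.sqrt 2 : ℝ) : ℂ) ≠ 0 := by
    intro h
    rw [h] at h2
    norm_num at h2
  have hsum : ∀ u v : ZMod 2, ∑ j : Fin 2, (if modeParity j + u = 0 then (1 : ℂ) else 0) *
      (if modeParity j + v = 0 then 1 else 0) = if u = v then 1 else 0 := by
    intro u v
    rw [Fin.sum_univ_two, modeParity_zero, modeParity_one]
    rcases zmod_two_cases u with rfl | rfl <;> rcases zmod_two_cases v with rfl | rfl <;>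
      simp [CharTwo.add_self_eq_zero]
  rw [square, plainCompose_apply, ← hsum, Finset.mul_sum, sgn_add]
  refine Finset.sum_congr rfl fun j _ => ?_
  simp only [adj, map_apply, plainMajorana, hat_apply, majorana_apply, star_mul', star_sgn,
    add_assoc]
  have hs : star (Complex.I ^ (k : ℕ) / ((Real.sqrt 2 : ℝ) : ℂ)) =
      (-Complex.I) ^ (k : ℕ) / ((Real.sqrt 2 : ℝ) : ℂ) := by
    simp
  have hi : ∀ q : Prop, [Decidable q] → star (if q then (1 : ℂ) else 0) = if q then 1 else 0 := by
    intro q _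
    split_ifs <;> simp
  rw [hs, hi]
  field_simp
  rw [pow_two, h2]
  ring

/-- One site suffices from this side, which is why the right map is an isometry. On the other side
two neighbouring sites are needed. -/
theorem square_plainMajorana_mulVec_bell (c : ZMod 2) (n m : Fin 2) :
    square (plainMajorana c) n m *ᵥ bell (Fin 2) = if n = m then bell (Fin 2) else 0 := by
  ext x
  obtain ⟨x₁, x₂⟩ := x
  simp only [mulVec, dotProduct, Fintype.sum_prod_type, Fin.sum_univ_two,
    square_plainMajorana_apply, bell]
  rcases zmod_two_cases c with rfl | rfl <;> fin_cases n <;> fin_cases m <;> fin_cases x₁ <;>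
    fin_cases x₂ <;> simp [modeParity, bell, CharTwo.add_self_eq_zero] <;> norm_num

theorem bell_vecMul_square_plainMajorana_self (c : ZMod 2) (n : Fin 2) :
    bell (Fin 2) ᵥ* square (plainMajorana c) n n = bell (Fin 2) := by
  ext x
  obtain ⟨x₁, x₂⟩ := x
  simp only [vecMul, dotProduct, Fintype.sum_prod_type, Fin.sum_univ_two,
    square_plainMajorana_apply, bell]
  rcases zmod_two_cases c with rfl | rfl <;> fin_cases n <;> fin_cases x₁ <;>
    fin_cases x₂ <;> simp [modeParity, CharTwo.add_self_eq_zero] <;> norm_num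

/-- An off-diagonal site leaves an antisymmetric vector on the odd pairs. -/
theorem bell_vecMul_square_plainMajorana_of_ne (c : ZMod 2) {n m : Fin 2} (h : n ≠ m) :
    (bell (Fin 2) ᵥ* square (plainMajorana c) n m) (0, 0) = 0 ∧
    (bell (Fin 2) ᵥ* square (plainMajorana c) n m) (1, 1) = 0 ∧
    (bell (Fin 2) ᵥ* square (plainMajorana c) n m) (0, 1) =
      -(bell (Fin 2) ᵥ* square (plainMajorana c) n m) (1, 0) := by
  simp only [vecMul, dotProduct, Fintype.sum_prod_type, Fin.sum_univ_two,
    square_plainMajorana_apply, bell]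
  rcases zmod_two_cases c with rfl | rfl <;> fin_cases n <;> fin_cases m <;>
    first
    | exact absurd rfl h
    | simp [modeParity, CharTwo.add_self_eq_zero]

theorem bell_vecMul_square_mul_square_plainMajorana (c c' : ZMod 2) (n m n' m' : Fin 2) :
    bell (Fin 2) ᵥ* (square (plainMajorana c) n m * square (plainMajorana c') n' m') =
      if n = m then bell (Fin 2) ᵥ* square (plainMajorana c') n' m' else 0 := by
  rw [← vecMul_vecMul]
  split_ifs with h
  · rw [h, bell_vecMul_square_plainMajorana_self]
  · obtain ⟨h0, h1, h2⟩ := bell_vecMul_square_plainMajorana_of_ne c h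
    set w := bell (Fin 2) ᵥ* square (plainMajorana c) n m
    -- Entries of the next site depend on the left pair only through the sum of its parities, so an
    -- antisymmetric vector is annihilated.
    have hrow : ∀ y, square (plainMajorana c') n' m' (0, 1) y =
        square (plainMajorana c') n' m' (1, 0) y := by
      intro y
      simp only [square_plainMajorana_apply, modeParity_zero, modeParity_one]
      congr 2
      apply propext
      generalize modeParity y.1 = u
      generalize modeParity y.2 = v
      generalize modeParity n' = s
      generalize modeParity m' = t
      decide +revert
    ext y
    rw [vecMul, dotProduct, Fintype.sum_prod_type]
    simp only [Fin.sum_univ_two, h0, h1, h2, hrow, Pi.zero_apply]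
    ring

/-! ### The Majorana shift with an ancilla -/

variable {Y : Type*} [DecidableEq Y] (y : Y → ZMod 2)

theorem isEven_majoranaShift : IsEven (siteParity y) modeParity (majoranaShift Y) := by
  intro n m α β h
  rw [majoranaShift, withAncilla] at h
  split_ifs at h with hy
  · rw [majorana_apply] at h
    have h1 := right_ne_zero_of_mul h
    split_ifs at h1 with h2
    · simp only [siteParity, addParity, hy]
      linear_combination h2 + CharTwo.add_self_eq_zero (y m.2)
    · exact absurd rfl h1
  · exact absurd rfl h

/-- The tensor of the Majorana shift with an ancilla, without signs. -/
def plainShift : MPOTensor (Fin 2 × Y) (Fin 2) := hat (siteParity y) modeParity (majoranaShift Y)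

theorem plainShift_eq (n m : Fin 2 × Y) :
    plainShift y n m = if n.2 = m.2 then plainMajorana (y m.2) n.1 m.1 else 0 := by
  ext α β
  rw [plainShift, hat_apply, majoranaShift, withAncilla]
  split_ifs
  · rfl
  · simp

variable [Fintype Y]

theorem square_plainShift (n m : Fin 2 × Y) : square (plainShift y) n m =
    if n.2 = m.2 then square (plainMajorana (y m.2)) n.1 m.1 else 0 := by
  ext a b
  rw [square, plainCompose_apply, Fintype.sum_prod_type]
  simp only [adj, map_apply, plainShift_eq]
  split_ifs with h
  · rw [square, plainCompose_apply]
    refine Finset.sum_congr rfl fun j _ => ?_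
    rw [Finset.sum_eq_single m.2]
    · simp [h, adj]
    · intro z _ hz
      simp [hz]
    · simp
  · refine Finset.sum_eq_zero fun j _ => Finset.sum_eq_zero fun z _ => ?_
    by_cases h1 : z = m.2
    · have : z ≠ n.2 := fun h2 => h (h2.symm.trans h1)
      simp [this]
    · simp [h1]

theorem plainBlock_square_plainShift_mulVec_bell (k : ℕ) (n m : Fin k → Fin 2 × Y) :
    plainBlock (square (plainShift y)) k n m *ᵥ bell (Fin 2) =
      if n = m then bell (Fin 2) else 0 := by
  have one : ∀ n m, square (plainShift y) n m *ᵥ bell (Fin 2) =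
      if n = m then bell (Fin 2) else 0 := by
    intro n m
    rw [square_plainShift]
    by_cases h2 : n.2 = m.2
    · rw [if_pos h2, square_plainMajorana_mulVec_bell]
      simp only [Prod.ext_iff, h2, and_true]
    · rw [if_neg h2, zero_mulVec, if_neg fun h => h2 (congrArg Prod.snd h)]
  induction k with
  | zero => simp [plainBlock, Subsingleton.elim n m]
  | succ k ih =>
    rw [plainBlock_succ, ← mulVec_mulVec, ih]
    have hiff : n = m ↔ n 0 = m 0 ∧ (fun i : Fin k => n i.succ) = fun i => m i.succ := by
      rw [funext_iff, Fin.forall_fin_succ, funext_iff]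
    by_cases h2 : (fun i : Fin k => n i.succ) = fun i => m i.succ
    · rw [if_pos h2, one]
      simp only [hiff, h2, and_true]
    · rw [if_neg h2, mulVec_zero, if_neg fun h => h2 (hiff.1 h).2]

theorem bell_vecMul_square_plainShift (k : ℕ) (n m : Fin 2 × Y) (n' m' : Fin (k + 1) → Fin 2 × Y) :
    bell (Fin 2) ᵥ* (square (plainShift y) n m * plainBlock (square (plainShift y)) (k + 1) n' m') =
      if n = m then bell (Fin 2) ᵥ* plainBlock (square (plainShift y)) (k + 1) n' m' else 0 := by
  have two : ∀ n m n' m', bell (Fin 2) ᵥ* (square (plainShift y) n m *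
      square (plainShift y) n' m') =
      if n = m then bell (Fin 2) ᵥ* square (plainShift y) n' m' else 0 := by
    intro n m n' m'
    rw [square_plainShift, square_plainShift]
    by_cases h2 : n'.2 = m'.2
    · by_cases h1 : n.2 = m.2
      · rw [if_pos h1, if_pos h2, bell_vecMul_square_mul_square_plainMajorana]
        simp only [Prod.ext_iff, h1, and_true]
      · rw [if_neg h1, if_neg fun h => h1 (congrArg Prod.snd h), Matrix.zero_mul, vecMul_zero]
    · rw [if_neg h2, Matrix.mul_zero, vecMul_zero, ite_self]
  rw [plainBlock_succ, ← Matrix.mul_assoc, ← vecMul_vecMul, two, ← vecMul_vecMul]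
  split_ifs
  · rfl
  · rw [zero_vecMul]

theorem gramVec_one (A : Type*) [Fintype A] [DecidableEq A] :
    gramVec (1 : Matrix A A ℂ) = bell A := by
  ext x
  simp [gramVec, bell, one_apply, eq_comm]

/-- The Gram matrix is the identity, so this square matrix is an isometry and hence invertible. -/
theorem isUnit_det_leftMap_flip_plainShift (k : ℕ) :
    IsUnit (leftMap (flip (plainBlock (plainShift y) k))).det := by
  have h := gram_leftMapF (1 : Matrix (Fin 2) (Fin 2) ℂ) (flip (plainBlock (plainShift y) k))
  have h1 : (Matrix.of fun x z : (Fin k → Fin 2 × Y) × Fin 2 =>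
      (gramVec (1 : Matrix (Fin 2) (Fin 2) ℂ) ᵥ*
        square (flip (plainBlock (plainShift y) k)) x.1 z.1) (x.2, z.2)) = 1 := by
    ext x z
    rw [of_apply, gramVec_one, square_flip, vecMul_transpose, ← plainBlock_square,
      plainBlock_square_plainShift_mulVec_bell, one_apply]
    by_cases h1 : x.1 = z.1 <;> simp [bell, h1, Prod.ext_iff]
  rw [h1, leftMapF_one] at h
  refine IsUnit.of_mul_eq_one (leftMap (flip (plainBlock (plainShift y) k)))ᴴ.det ?_
  rw [mul_comm, ← det_mul, h, det_one]

/-- A nonzero entry requires equal total parity of row and column, and its value depends only on the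
column. The map therefore factors through the two parities. -/
theorem rank_leftMap_majorana : (leftMap majorana).rank = 2 := by
  have h2 : ((Real.sqrt 2 : ℝ) : ℂ) * (Real.sqrt 2 : ℝ) = 2 := by
    rw [← Complex.ofReal_mul, Real.mul_self_sqrt zero_le_two]
    norm_num
  have h0 : ((Real.sqrt 2 : ℝ) : ℂ) ≠ 0 := by
    intro h
    rw [h] at h2
    norm_num at h2
  apply le_antisymm
  · have : leftMap majorana =
        (Matrix.of fun (x : Fin 2 × Fin 2) (s : Fin 2) =>
          if modeParity x.1 + modeParity x.2 = modeParity s then (1 : ℂ) else 0) *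
        Matrix.of fun (s : Fin 2) (x : Fin 2 × Fin 2) =>
          if modeParity x.1 + modeParity x.2 = modeParity s then
            Complex.I ^ (x.1 : ℕ) / ((Real.sqrt 2 : ℝ) : ℂ) else 0 := by
      ext ⟨n, α⟩ ⟨m, β⟩
      simp only [leftMap, of_apply, majorana_apply, mul_apply, Fin.sum_univ_two]
      fin_cases n <;> fin_cases m <;> fin_cases α <;> fin_cases β <;>
        simp [modeParity, CharTwo.add_self_eq_zero]
    rw [this]
    exact (rank_mul_le_left _ _).trans (rank_le_card_width _)
  -- The submatrix with `n = m = 0` is the identity divided by `√2`.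
  · have : (1 : Matrix (Fin 2) (Fin 2) ℂ) =
        (Matrix.of fun (s : Fin 2) (x : Fin 2 × Fin 2) =>
          if x = (0, s) then ((Real.sqrt 2 : ℝ) : ℂ) else 0) * (leftMap majorana *
        Matrix.of fun (x : Fin 2 × Fin 2) (s : Fin 2) => if x = (0, s) then (1 : ℂ) else 0) := by
      ext s t
      simp only [leftMap, of_apply, majorana_apply, mul_apply, Fintype.sum_prod_type,
        Fin.sum_univ_two]
      fin_cases s <;> fin_cases t <;> simp [modeParity, CharTwo.add_self_eq_zero, h0]
    have h3 := congrArg Matrix.rank this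
    rw [rank_one, Fintype.card_fin] at h3
    exact h3.trans_le <| (rank_mul_le_right _ _).trans (rank_mul_le_left _ _)

theorem rank_leftMap_plainShift : (leftMap (plainShift y)).rank = 2 * Fintype.card Y := by
  rw [plainShift, ← leftRank_eq, leftRank]
  refine Eq.trans ?_ (congrArg₂ (· * ·) rank_leftMap_majorana (rank_one (R := ℂ) (n := Y)))
  rw [← rank_kronecker]
  let e : (Fin 2 × Y) × Fin 2 ≃ (Fin 2 × Fin 2) × Y :=
    ⟨fun x => ((x.1.1, x.2), x.1.2), fun x => ((x.1.1, x.2), x.1.2), fun _ => rfl, fun _ => rfl⟩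
  rw [← rank_submatrix (leftMap majorana ⊗ₖ (1 : Matrix Y Y ℂ)) e e]
  congr 1
  ext x z
  simp only [leftMap, of_apply, majoranaShift, withAncilla, submatrix_apply, kroneckerMap_apply, e,
    Equiv.coe_fn_mk, one_apply, mul_ite, mul_one, mul_zero]
  split_ifs <;> rfl

theorem rank_leftMap_plainBlock_plainShift (k : ℕ) :
    (leftMap (plainBlock (plainShift y) (k + 1))).rank = (2 * Fintype.card Y) ^ (k + 1) := by
  have hone : ∀ V : MPOTensor (Fin 2 × Y) (Fin 2), (leftMap (plainBlock V 1)).rank =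
      (leftMap V).rank := fun V => rank_leftMap_congr (Equiv.funUnique (Fin 1) _).symm fun n m => by
    simp [plainBlock]
  induction k with
  | zero => rw [zero_add, hone, rank_leftMap_plainShift, pow_one]
  | succ k ih =>
    rw [add_comm (k + 1) 1, rank_leftMap_plainBlock_add, ← leftMapF_one, rank_leftMapF_plainCat,
      leftMapF_one, ih]
    · simp [pow_add]
    · intro n m n' m'
      rw [gramVec_one, ← plainBlock_square, ← plainBlock_square]
      have h : plainBlock (square (plainShift y)) 1 n m = square (plainShift y) (n 0) (m 0) := by
        simp [plainBlock]
      rw [h, bell_vecMul_square_plainShift]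
      have hiff : n = m ↔ n 0 = m 0 := by
        rw [funext_iff, Fin.forall_fin_one]
      simp only [hiff]

theorem leftRank_block_majoranaShift {k : ℕ} (hk : 1 ≤ k) :
    leftRank (block (siteParity y) (majoranaShift Y) k) = (2 * Fintype.card Y) ^ k := by
  obtain ⟨k, rfl⟩ := Nat.exists_eq_add_of_le' hk
  rw [leftRank_eq (chainParity (siteParity y) (k + 1)) modeParity,
    hat_block (isEven_majoranaShift y)]
  exact rank_leftMap_plainBlock_plainShift y k

theorem rightRank_block_majoranaShift (k : ℕ) :
    rightRank (chainParity (siteParity y) k) (block (siteParity y) (majoranaShift Y) k) =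
      2 * (2 * Fintype.card Y) ^ k := by
  rw [rightRank_eq ((isEven_majoranaShift y).block k), hat_block (isEven_majoranaShift y)]
  have h := isUnit_det_leftMap_flip_plainShift y k
  rw [← isUnit_iff_isUnit_det] at h
  refine (rank_of_isUnit _ h).trans ?_
  simp [mul_comm]

end Majorana

/-! ### Ranks of blocked compositions -/

section Index

variable {P A B : Type*}

theorem transpose_gauge [DecidableEq A] [DecidableEq B] (a : A → ZMod 2) (b : B → ZMod 2) :
    (gauge a b)ᵀ = gauge a b := by
  simp [gauge]

theorem leftRank_compose [Fintype P] [Fintype A] [Fintype B] {p : P → ZMod 2}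
    {a : A → ZMod 2} {b : B → ZMod 2} {U : MPOTensor P A} {N : MPOTensor P B} (hU : IsEven p a U)
    (hN : IsEven p b N) : leftRank (compose p b U N) =
      (leftMap (plainCompose (hat p a U) (hat p b N))).rank := by
  classical
  rw [leftRank_eq p (addParity a b)]
  exact rank_leftMap_conj (gauge_mul_gauge a b) (hat_compose hU hN)

theorem rightRank_compose [Fintype P] [Fintype A] [Fintype B] {p : P → ZMod 2}
    {a : A → ZMod 2} {b : B → ZMod 2} {U : MPOTensor P A} {N : MPOTensor P B} (hU : IsEven p a U)
    (hN : IsEven p b N) : rightRank p (compose p b U N) =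
      (leftMap (plainCompose (flip (hat p a U)) (flip (hat p b N)))).rank := by
  classical
  rw [rightRank_eq (hU.compose hN), plainCompose_flip]
  refine rank_leftMap_conj (gauge_mul_gauge a b) fun n m => ?_
  rw [flip, flip, hat_compose hU hN, transpose_mul, transpose_mul, transpose_gauge,
    Matrix.mul_assoc]

variable [Fintype A] [DecidableEq A] {s : A → Prop}

theorem plainBlock_eq_zero_of_left {V : MPOTensor P A}
    (hV : ∀ n m α β, ¬ s α → V n m α β = 0) {k : ℕ} (hk : 1 ≤ k) (n m : Fin k → P) (α β : A)
    (hα : ¬ s α) : plainBlock V k n m α β = 0 := by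
  obtain ⟨k, rfl⟩ := Nat.exists_eq_add_of_le' hk
  rw [plainBlock_succ, mul_apply]
  exact Finset.sum_eq_zero fun x _ => by rw [hV _ _ _ _ hα, zero_mul]

theorem plainBlock_eq_zero_of_right {V : MPOTensor P A}
    (hV : ∀ n m α β, ¬ s β → V n m α β = 0) {k : ℕ} (hk : 1 ≤ k) (n m : Fin k → P) (α β : A)
    (hβ : ¬ s β) : plainBlock V k n m α β = 0 := by
  induction k, hk using Nat.le_induction generalizing α with
  | base => simp [plainBlock, hV _ _ _ _ hβ]
  | succ k _ ih =>
    rw [plainBlock_succ, mul_apply]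
    exact Finset.sum_eq_zero fun x _ => by rw [ih, mul_zero]

variable [Fintype P] [Nonempty P] {p : P → ZMod 2} {a : A → ZMod 2}
    {U : MPOTensor P A} {k : ℕ}

theorem transferMatrix_plainBlock_eq (U : MPOTensor P A) (k : ℕ) :
    transferMatrix (plainBlock U k) = (Fintype.card P : ℂ) ^ k • normTransferMatrix U ^ k := by
  have hd : (Fintype.card P : ℂ) ≠ 0 := Nat.cast_ne_zero.2 Fintype.card_ne_zero
  rw [transferMatrix_plainBlock, normTransferMatrix, smul_pow, smul_smul, ← mul_pow,
    mul_inv_cancel₀ hd, one_pow, one_smul]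

variable [DecidableEq P]

/-- The vector of the words passes to the right through the matrices of at least `k` sites. -/
theorem gramVec_wordMatrix_vecMul (hU : GeneratesTypeI p a U) (hk : 1 ≤ k)
    (hS : IsSimple (chainParity p k) a (block p U k)) (r : ℕ) (n m : Fin (r + k) → P)
    (n' m' : Fin k → P) :
    gramVec (wordMatrix U k) ᵥ* (square (plainBlock (hat p a U) (r + k)) n m *
        square (plainBlock (hat p a U) k) n' m') =
      if n = m then gramVec (wordMatrix U k) ᵥ* square (plainBlock (hat p a U) k) n' m'
      else 0 := by
  have hD := isSimpleData hU hk hS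
  have h := hD.mul_block_mul (hD.collapses hk (r + k)) n m n' m'
  rw [gramVec_wordMatrix, transferMatrix_plainBlock_eq, ← plainBlock_square, ← plainBlock_square,
    vecMul_vecMul, Matrix.smul_mul, h, vecMul_vecMul, Matrix.smul_mul]
  split_ifs
  · rfl
  · rw [smul_zero, vecMul_zero]

theorem gramVec_wordMatrixLeft_vecMul (hU : GeneratesTypeI p a U) (hk : 1 ≤ k)
    (hS : IsSimple (chainParity p k) a (block p U k)) (r : ℕ) (n m : Fin (k + r) → P)
    (n' m' : Fin k → P) :
    gramVec (wordMatrixLeft U k) ᵥ* (square (flip (plainBlock (hat p a U) (k + r))) n m *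
        square (flip (plainBlock (hat p a U) k)) n' m') =
      if n = m then
        gramVec (wordMatrixLeft U k) ᵥ* square (flip (plainBlock (hat p a U) k)) n' m'
      else 0 := by
  have hD := isSimpleData hU hk hS
  have h := hD.block_mul_mul (hD.collapses hk (k + r)) n' m' n m
  rw [gramVec_wordMatrixLeft, transferMatrix_plainBlock_eq, square_flip, square_flip,
    ← transpose_mul, vecMul_transpose, vecMul_transpose, ← plainBlock_square, ← plainBlock_square,
    mulVec_mulVec, mulVec_mulVec, Matrix.mul_smul, Matrix.mul_smul, h]
  split_ifs
  · rfl
  · rw [smul_zero, zero_mulVec]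

/-- With `k + r` sites peeled off on the left, each contributes a factor of the physical dimension
and the last `k` sites give the right rank of the simple block, because transposition exchanges the
two ends of the chain. -/
theorem rightRank_block_add (hG : IsGCF p a U) (hU : GeneratesTypeI p a U) (hk : 1 ≤ k)
    (hS : IsSimple (chainParity p k) a (block p U k)) (r : ℕ) :
    (leftMap (flip (plainBlock (hat p a U) (k + (k + r))))).rank =
      Fintype.card P ^ (k + r) * rightRank (chainParity p k) (block p U k) := by
  obtain ⟨s, -, hs, -, hF⟩ := hG.exists_support
  have hV : ∀ n m α β, ¬ s β → hat p a U n m α β = 0 := fun n m α β h => by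
    rw [hat_apply, hs _ _ _ _ h, mul_zero]
  have h1 := rank_leftMapF_plainCat (gramVec_wordMatrixLeft_vecMul hU hk hS r)
  rw [rank_leftMapF_of_injectiveOnSupport (hF k), rank_leftMapF_of_injectiveOnSupport (hF k)] at h1
  · rw [rank_leftMap_flip_plainBlock_add, h1, rightRank_eq (hU.1.block k), hat_block hU.1]
    simp
  · exact fun n m α β h => plainBlock_eq_zero_of_right hV hk n m β α h
  · intro n m α β h
    rw [plainCat, mul_apply]
    exact Finset.sum_eq_zero fun x _ => mul_eq_zero_of_left
      (plainBlock_eq_zero_of_right hV (by omega) _ _ x α h) _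

/-- Rank zero would make the tensor and its transfer matrix vanish, against `tr E ^ k = 1`. -/
theorem leftRank_block_pos (hU : GeneratesTypeI p a U) (hk : 1 ≤ k) :
    0 < leftRank (block p U k) := by
  rw [Nat.pos_iff_ne_zero]
  intro h0
  have h1 := trace_normTransferMatrix_pow hU k hk
  have h2 : leftMap (block p U k) = 0 := by
    have h3 : LinearMap.range (leftMap (block p U k)).mulVecLin = ⊥ :=
      Submodule.finrank_eq_zero.1 h0
    rw [LinearMap.range_eq_bot] at h3
    refine Matrix.ext_of_mulVec_single fun i => ?_
    rw [zero_mulVec]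
    exact LinearMap.congr_fun h3 _
  have h4 : ∀ n m, block p U k n m = 0 := by
    intro n m
    ext α β
    exact congrFun (congrFun h2 (n, α)) (m, β)
  have h5 : normTransferMatrix U ^ k = 0 := by
    rw [← normTransferMatrix_block p, normTransferMatrix, transferMatrix_eq_sum]
    simp [h4]
  rw [h5, trace_zero] at h1
  exact zero_ne_one h1

/-! ### Composition of a type I tensor with the shift -/

variable {Y : Type*} [Fintype Y] [DecidableEq Y] {y : Y → ZMod 2}
  {U : MPOTensor (Fin 2 × Y) A}

theorem block_timesShift (hU : IsEven (siteParity y) a U) (q : ℕ) :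
    block (siteParity y) (timesShift y U) q = compose (chainParity (siteParity y) q) modeParity
      (block (siteParity y) U q) (block (siteParity y) (majoranaShift Y) q) :=
  block_compose hU (isEven_majoranaShift y) q

theorem rightRank_block_timesShift (hU : IsEven (siteParity y) a U) (q : ℕ) :
    rightRank (chainParity (siteParity y) q) (block (siteParity y) (timesShift y U) q) =
      2 * (leftMap (flip (plainBlock (hat (siteParity y) a U) q))).rank := by
  rw [block_timesShift hU, rightRank_compose (hU.block q) ((isEven_majoranaShift y).block q),
    hat_block hU, hat_block (isEven_majoranaShift y)]
  exact (rank_leftMap_plainCompose_of_isUnit _ (isUnit_det_leftMap_flip_plainShift y q)).trans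
    (by rw [Fintype.card_fin])

variable [Nonempty Y]

/-- The first `r + k` sites contribute the left rank of the shift and the last `k` sites that of the
simple block. -/
theorem leftRank_block_timesShift (hG : IsGCF (siteParity y) a U)
    (hU : GeneratesTypeI (siteParity y) a U) (hk : 1 ≤ k)
    (hS : IsSimple (chainParity (siteParity y) k) a (block (siteParity y) U k)) (r : ℕ) :
    leftRank (block (siteParity y) (timesShift y U) (r + k + k)) =
      (2 * Fintype.card Y) ^ (r + k) * leftRank (block (siteParity y) U k) := by
  obtain ⟨s, hs, -, hF, -⟩ := hG.exists_support
  have hV : ∀ n m α β, ¬ s α → hat (siteParity y) a U n m α β = 0 := fun n m α β h => by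
    rw [hat_apply, hs _ _ _ _ h, mul_zero]
  have hrank : ∀ j, 1 ≤ j → (leftMap (plainBlock (plainShift y) j)).rank =
      (2 * Fintype.card Y) ^ j := by
    intro j hj
    obtain ⟨j, rfl⟩ := Nat.exists_eq_add_of_le' hj
    exact rank_leftMap_plainBlock_plainShift y j
  rw [block_timesShift hU.1, leftRank_compose (hU.1.block _) ((isEven_majoranaShift y).block _),
    hat_block hU.1, hat_block (isEven_majoranaShift y), rank_leftMap_plainCompose_plainBlock_add]
  refine (rank_leftMap_plainCompose_plainCat (hF k)
    (plainBlock_eq_zero_of_left hV (by omega)) (plainBlock_eq_zero_of_left hV hk) ?_ ?_).trans ?_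
  · intro n m n' m'
    rw [gramVec_wordMatrix_vecMul hU hk hS]
    split_ifs <;> rfl
  · rw [← rank_leftMap_plainBlock_add]
    change (leftMap (plainBlock (plainShift y) (r + k + k))).rank =
      _ * (leftMap (plainBlock (plainShift y) (r + k))).rank
    rw [hrank _ (by omega), hrank _ (by omega), pow_add _ (r + k) k, mul_comm]
    simp
  · rw [leftRank_eq (chainParity (siteParity y) k) a, hat_block hU.1]
    exact congrArg (· * _) (hrank (r + k) (by omega))

theorem expIndex_block_timesShift (hG : IsGCF (siteParity y) a U)
    (hU : GeneratesTypeI (siteParity y) a U) (hk : 1 ≤ k)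
    (hS : IsSimple (chainParity (siteParity y) k) a (block (siteParity y) U k)) {q : ℕ}
    (hq : 2 * k ≤ q) :
    0 < leftRank (block (siteParity y) (timesShift y U) q) ∧
      expIndex (chainParity (siteParity y) q) (block (siteParity y) (timesShift y U) q) =
        Real.sqrt 2 * expIndex (chainParity (siteParity y) k) (block (siteParity y) U k) := by
  -- Two stretches of `k` sites are needed: one to be collapsed by `Q`, and one to carry the rank of
  -- the simple block.
  obtain ⟨r, rfl⟩ := Nat.exists_eq_add_of_le' hq
  have hd : 0 < 2 * Fintype.card Y := Nat.mul_pos two_pos Fintype.card_pos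
  have hl : leftRank (block (siteParity y) (timesShift y U) (r + 2 * k)) =
      (2 * Fintype.card Y) ^ (r + k) * leftRank (block (siteParity y) U k) := by
    rw [two_mul, ← add_assoc, leftRank_block_timesShift hG hU hk hS]
  have hr : rightRank (chainParity (siteParity y) (r + 2 * k))
      (block (siteParity y) (timesShift y U) (r + 2 * k)) =
      2 * ((2 * Fintype.card Y) ^ (r + k) *
        rightRank (chainParity (siteParity y) k) (block (siteParity y) U k)) := by
    have h := rightRank_block_add hG hU hk hS r
    have e : k + (k + r) = r + 2 * k := by ring
    rw [e, Fintype.card_prod, Fintype.card_fin, add_comm k r] at h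
    rw [rightRank_block_timesShift hU.1, h]
  have hpow : 0 < (2 * Fintype.card Y) ^ (r + k) := pow_pos hd _
  refine ⟨hl ▸ Nat.mul_pos hpow (leftRank_block_pos hU hk), ?_⟩
  rw [expIndex, expIndex, ← Real.sqrt_mul zero_le_two, hl, hr]
  congr 1
  have h1 : (((2 * Fintype.card Y) ^ (r + k) : ℕ) : ℝ) ≠ 0 := Nat.cast_ne_zero.2 hpow.ne'
  rw [Nat.cast_mul, Nat.cast_mul, Nat.cast_mul _ (leftRank _), mul_left_comm, Nat.cast_ofNat,
    mul_div_mul_left _ _ h1, mul_div_assoc]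

end Index

end FMPU

end

theorem mainTheorem10 {Y : Type*} [Fintype Y] [DecidableEq Y] [Nonempty Y] (y : Y → ZMod 2) :
    -- right and left ranks of the blocked tensors of the Majorana shift with an ancilla
    (∀ k : ℕ, 1 ≤ k →
      FMPU.rightRank (FMPU.chainParity (FMPU.siteParity y) k)
          (FMPU.block (FMPU.siteParity y) (FMPU.majoranaShift Y) k) =
        2 * (2 * Fintype.card Y) ^ k ∧
      FMPU.leftRank (FMPU.block (FMPU.siteParity y) (FMPU.majoranaShift Y) k) =
        (2 * Fintype.card Y) ^ k) ∧
    -- the composition of a type I fMPU with the Majorana shift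
    (∀ {A : Type*} [Fintype A] [DecidableEq A] (a : A → ZMod 2)
      (U : FMPU.MPOTensor (Fin 2 × Y) A),
      FMPU.IsGCF (FMPU.siteParity y) a U →
      FMPU.GeneratesTypeI (FMPU.siteParity y) a U →
      -- the composed tensor generates the product of the two operators
      (∀ (θ : ℝ) (N : ℕ), 1 ≤ N →
        FMPU.abcOperator (FMPU.siteParity y)
            (Complex.exp (θ * Complex.I) / (Real.sqrt 2 : ℂ)) (FMPU.timesShift y U) N =
          FMPU.abcOperator (FMPU.siteParity y) (Complex.exp (θ * Complex.I)) U N *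
            FMPU.abcOperator (FMPU.siteParity y) (1 / (Real.sqrt 2 : ℂ))
              (FMPU.majoranaShift Y) N) ∧
      -- and its exponentiated index is `√2` times that of the type I factor
      ∀ k : ℕ, 1 ≤ k →
        FMPU.IsSimple (FMPU.chainParity (FMPU.siteParity y) k) a
          (FMPU.block (FMPU.siteParity y) U k) →
        ∀ q : ℕ, 2 * k ≤ q →
          0 < FMPU.leftRank (FMPU.block (FMPU.siteParity y) U k) ∧
          0 < FMPU.leftRank (FMPU.block (FMPU.siteParity y) (FMPU.timesShift y U) q) ∧
          FMPU.expIndex (FMPU.chainParity (FMPU.siteParity y) q)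
              (FMPU.block (FMPU.siteParity y) (FMPU.timesShift y U) q) =
            Real.sqrt 2 *
              FMPU.expIndex (FMPU.chainParity (FMPU.siteParity y) k)
                (FMPU.block (FMPU.siteParity y) U k)) := by
  refine ⟨fun k hk => ⟨FMPU.rightRank_block_majoranaShift y k,
    FMPU.leftRank_block_majoranaShift y hk⟩, fun a U hG hU => ⟨fun θ N _ => ?_,
    fun k hk hS q hq => ⟨FMPU.leftRank_block_pos hU hk,
      FMPU.expIndex_block_timesShift hG hU hk hS hq⟩⟩⟩
  rw [FMPU.timesShift, div_eq_mul_one_div]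
  exact FMPU.abcOperator_compose hU.1 (FMPU.isEven_majoranaShift y) _ _ N
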